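/- Let $\Lambda=\mathbb Z[t^{\pm1}]$. Let $L$ be a classical oriented link with two components, presented by a link diagram $D$ without virtual crossings, with set of arcs $A(D)$ and set of crossings $C(D)$. At a crossing $c$ let $a(c)$ be the overpassing arc, and let $b_1(c)$ and $b_2(c)$ be the underpassing arcs on the right and on the left of $a(c)$, respectively. The medial quandle $\mathrm{MQ}(L)$ is the medial quandle with a generator $q_a$ for each $a\in A(D)$ and a relation $q_{b_1(c)}\triangleright q_{a(c)}=q_{b_2(c)}$ for each $c\in C(D)$; medial means that $(w\triangleright x)\triangleright(y\triangleright z)=(w\triangleright y)\triangleright(x\triangleright z)$ for all $w,x,y,z$. The reduced Alexander module $M=M_A^{\mathrm{red}}(L)$ is the quotient of the free $\Lambda$-module on $A(D)$ by the submodule generated by the elements $(1-t)a(c)+t\,b_1(c)-b_2(c)$, $c\in C(D)$. The reduced Crowell map $\phi_L^{\mathrm{red}}:M\to\Lambda$ is the $\Lambda$-linear map that sends the generator of $M$ given by any arc to $1$. Let $N=\ker\phi_L^{\mathrm{red}}$ and $X=\{x\in N\mid (1-t)x=0\}$. If $I$ is a nonempty set, $m_i\in M$ for $i\in I$ with $m_i-m_j\in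 N$ for all $i,j\in I$, and $X_i$ is a submodule of $N$ with $(1-t)X_i=0$ for each $i\in I$, then $Q(N,(m_i),(X_i))$ denotes the medial quandle whose underlying set is the disjoint union of the quotients $N/X_i$, $i\in I$, with $$(x+X_i)\triangleright(y+X_j)=m_j-m_i+tx+(1-t)y+X_i\qquad(x,y\in N).$$ Theorem. The group $N/(1-t)N$ is isomorphic to $\mathbb Z$. If $d$ is any element of $N$ whose coset $d+(1-t)N$ generates $N/(1-t)N$, then the medial quandles $\mathrm{MQ}(L)$ and $Q(N,(d,0),(X,X))$ are isomorphic. -/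

import Mathlib

open LaurentPolynomial
open scoped Quandles

/-- The ring `Λ = ℤ[t, t⁻¹]`; the indeterminate is `t = T 1`. -/
abbrev Lam : Type := LaurentPolynomial ℤ

/-- The indeterminate `t` of `Λ`. -/
noncomputable abbrev tt : Lam := T 1

/-! ### Link diagrams

The underlying 4-valent graph of an oriented diagram is recorded by its half-edges.  At each crossing
the four half-edges are listed counterclockwise, beginning with the outgoing end of the overpassing
strand:
`0` is the outgoing end of the overpassing strand,
`1` is the end of the underpassing strand on the left of the overpassing strand,
`2` is the incoming end of the overpassing strand,
`3` is the end of the underpassing strand on the right of the overpassing strand.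
The underpassing strand runs from right to left at a positive crossing, from left to right at a
negative one. -/

/-- The half-edge `(c, k)`, with `k` a position at the crossing `c` as above, points away from the
crossing (`true`) or into it (`false`). -/
def halfEdgeOut {n : ℕ} (positive : Fin n → Bool) : Fin n × Fin 4 → Bool
  | (_, 0) => true
  | (c, 1) => positive c
  | (_, 2) => false
  | (c, 3) => !(positive c)

/-- An oriented (virtual) link diagram, as a signed Gauss code: `n` classical crossings with their
signs, the way in which the half-edges at the crossings are joined in pairs to form the edges of the
diagram (outgoing ends to incoming ends), and the number of components without classical crossings.
Virtual crossings are not recorded: the diagram is considered up to detour moves. -/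
structure LinkDiagram where
  /-- The number of classical crossings. -/
  n : ℕ
  /-- The signs of the crossings. -/
  positive : Fin n → Bool
  /-- The other end of the edge that begins with a given half-edge. -/
  opp : Fin n × Fin 4 → Fin n × Fin 4
  opp_opp : ∀ h, opp (opp h) = h
  out_opp : ∀ h, halfEdgeOut positive (opp h) = !(halfEdgeOut positive h)
  /-- The number of components on which there are no classical crossings. -/
  circles : ℕ

namespace LinkDiagram

variable (D : LinkDiagram)

/-- The set `C(D)` of crossings. -/
abbrev Crossing : Type := Fin D.n

/-- The half-edges. -/
abbrev HalfEdge : Type := Fin D.n × Fin 4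

/-- Rotation by a quarter turn, counterclockwise, about a crossing. -/
def rot (h : D.HalfEdge) : D.HalfEdge := (h.1, h.2 + 1)

/-- The arcs on the components that have crossings: half-edges are identified if they are the two
ends of an edge, or the two ends of the overpassing strand at a crossing. -/
inductive ArcStep : D.HalfEdge → D.HalfEdge → Prop
  | edge (h : D.HalfEdge) : ArcStep h (D.opp h)
  | overpass (c : D.Crossing) : ArcStep (c, 0) (c, 2)

/-- The set `A(D)` of arcs. A component without crossings is a single arc. -/
def Arc : Type := Quot D.ArcStep ⊕ Fin D.circles

/-- The arc that contains a given half-edge. -/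
def arcOf (h : D.HalfEdge) : D.Arc := Sum.inl (Quot.mk _ h)

/-- The overpassing arc at a crossing. -/
def a (c : D.Crossing) : D.Arc := D.arcOf (c, 0)

/-- The underpassing arc on the right of the overpassing arc. -/
def b₁ (c : D.Crossing) : D.Arc := D.arcOf (c, 3)

/-- The underpassing arc on the left of the overpassing arc. -/
def b₂ (c : D.Crossing) : D.Arc := D.arcOf (c, 1)

/-- Following a component: along an edge, or straight through a crossing. -/
inductive ComponentStep : D.HalfEdge → D.HalfEdge → Prop
  | edge (h : D.HalfEdge) : ComponentStep h (D.opp h)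
  | through (h : D.HalfEdge) : ComponentStep h (D.rot (D.rot h))

/-- The components `K₁, …, K_μ` of the link. -/
def Component : Type := Quot D.ComponentStep ⊕ Fin D.circles

/-- The number `μ` of components of the link. -/
noncomputable def numComponents : ℕ := Nat.card D.Component

/-- Moving within a connected piece of the 4-valent graph. -/
inductive PieceStep : D.HalfEdge → D.HalfEdge → Prop
  | edge (h : D.HalfEdge) : PieceStep h (D.opp h)
  | turn (h : D.HalfEdge) : PieceStep h (D.rot h)

/-- The connected components of the 4-valent graph. -/
def Piece : Type := Quot D.PieceStep

/-- The faces of the 4-valent graph, i.e. the cycles of the permutation `rot ∘ opp` of the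
half-edges: the boundary circuits of the surface obtained by thickening the graph. -/
def Face : Type := Quot (fun h h' : D.HalfEdge => h' = D.rot (D.opp h))

/-- The diagram is classical, i.e. it can be drawn in the plane without virtual crossings: capping
off the faces gives a surface all of whose pieces are spheres. As no piece can have an Euler
characteristic greater than 2, this is Euler's formula `V - E + F = 2 * #pieces`, where `V` is the
number of crossings, and `E = 2 * V`. -/
def IsClassical : Prop :=
  (D.n : ℤ) - 2 * D.n + Nat.card D.Face = 2 * Nat.card D.Piece

end LinkDiagram

/-! ### Medial quandles presented by generators and relations

Mathlib writes quandle operations with the acting element on the left: the element written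
`x ▷ y` by authors who let quandles act on the right is `y ◃ x`. A quandle is medial if
`(w ▷ x) ▷ (y ▷ z) = (w ▷ y) ▷ (x ▷ z)`, which is Mathlib's `Rack.IsAbelian`. -/

/-- Formal quandle expressions in generators from `A`; `act y x` stands for `x ▷ y`, and
`invAct y x` for the element `z` with `z ▷ y = x`. -/
inductive QuandleExpr (A : Type) : Type
  | gen (i : A) : QuandleExpr A
  | act (y x : QuandleExpr A) : QuandleExpr A
  | invAct (y x : QuandleExpr A) : QuandleExpr A

/-- The smallest congruence that imposes the laws of medial quandles and the relations
`b₁ c ▷ a c = b₂ c`. -/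
inductive MedialRel {A C : Type} (b₁ a b₂ : C → A) : QuandleExpr A → QuandleExpr A → Prop
  | refl (x) : MedialRel b₁ a b₂ x x
  | symm {x y} : MedialRel b₁ a b₂ x y → MedialRel b₁ a b₂ y x
  | trans {x y z} : MedialRel b₁ a b₂ x y → MedialRel b₁ a b₂ y z → MedialRel b₁ a b₂ x z
  | congr_act {y y' x x'} : MedialRel b₁ a b₂ y y' → MedialRel b₁ a b₂ x x' →
      MedialRel b₁ a b₂ (.act y x) (.act y' x')
  | congr_invAct {y y' x x'} : MedialRel b₁ a b₂ y y' → MedialRel b₁ a b₂ x x' →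
      MedialRel b₁ a b₂ (.invAct y x) (.invAct y' x')
  | self_distrib (x y z) :
      MedialRel b₁ a b₂ (.act x (.act y z)) (.act (.act x y) (.act x z))
  | left_inv (x y) : MedialRel b₁ a b₂ (.invAct x (.act x y)) y
  | right_inv (x y) : MedialRel b₁ a b₂ (.act x (.invAct x y)) y
  | fix (x) : MedialRel b₁ a b₂ (.act x x) x
  | medial (x y z w) :
      MedialRel b₁ a b₂ (.act (.act x y) (.act z w)) (.act (.act x z) (.act y w))
  | rel (c : C) : MedialRel b₁ a b₂ (.act (.gen (a c)) (.gen (b₁ c))) (.gen (b₂ c))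

/-- The setoid of `MedialRel`. -/
def MedialRel.setoid {A C : Type} (b₁ a b₂ : C → A) : Setoid (QuandleExpr A) where
  r := MedialRel b₁ a b₂
  iseqv := ⟨.refl, .symm, .trans⟩

/-- The medial quandle with generators `A` and relations `b₁ c ▷ a c = b₂ c` for `c` in `C`. -/
def PresentedMedialQuandle {A C : Type} (b₁ a b₂ : C → A) : Type :=
  Quotient (MedialRel.setoid b₁ a b₂)

instance {A C : Type} (b₁ a b₂ : C → A) : Quandle (PresentedMedialQuandle b₁ a b₂) where
  act := Quotient.map₂ .act fun _ _ h _ _ h' => .congr_act h h'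
  self_distrib := by
    rintro ⟨x⟩ ⟨y⟩ ⟨z⟩
    exact Quotient.sound (.self_distrib x y z)
  invAct := Quotient.map₂ .invAct fun _ _ h _ _ h' => .congr_invAct h h'
  left_inv := by
    rintro ⟨x⟩ ⟨y⟩
    exact Quotient.sound (.left_inv x y)
  right_inv := by
    rintro ⟨x⟩ ⟨y⟩
    exact Quotient.sound (.right_inv x y)
  fix := by
    rintro ⟨x⟩
    exact Quotient.sound (.fix x)

/-- The medial quandle `MQ(L)`, computed from a diagram `D` of `L`. -/
abbrev LinkDiagram.MQ (D : LinkDiagram) : Type := PresentedMedialQuandle D.b₁ D.a D.b₂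

/-! ### The reduced Alexander module and the reduced Crowell map -/

namespace LinkDiagram

variable (D : LinkDiagram)

/-- The map `Λ^C(D) → Λ^A(D)`, `c ↦ (1 - t) a(c) + t b₁(c) - b₂(c)`. -/
noncomputable def rhoRed : (D.Crossing →₀ Lam) →ₗ[Lam] (D.Arc →₀ Lam) :=
  Finsupp.linearCombination Lam fun c =>
    (1 - tt) • Finsupp.single (D.a c) 1 + tt • Finsupp.single (D.b₁ c) 1
      - Finsupp.single (D.b₂ c) 1

/-- The reduced Alexander module of the link: the cokernel of `rhoRed`. -/
abbrev AlexanderModuleRed : Type := (D.Arc →₀ Lam) ⧸ LinearMap.range D.rhoRed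

/-- The reduced Crowell map, under which the generator of each arc is mapped to `1`. -/
noncomputable def crowellRed : D.AlexanderModuleRed →ₗ[Lam] Lam :=
  (LinearMap.range D.rhoRed).liftQ (Finsupp.linearCombination Lam fun _ => 1) (by
    rw [LinearMap.range_le_ker_iff]
    ext c
    simp [rhoRed])

/-- The reduced Alexander invariant of the link. -/
noncomputable abbrev alexanderInvariantRed : Submodule Lam D.AlexanderModuleRed :=
  LinearMap.ker D.crowellRed

end LinkDiagram

/-! ### The medial quandles `Q(N, (mᵢ), (Xᵢ))` -/

/-- The data that define a quandle `Q(N, (mᵢ), (Xᵢ))`, where `N` is a submodule of a `Λ`-module `M`: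
elements `mᵢ` of `M` that are congruent to each other modulo `N`, and submodules `Xᵢ` of `N` that are
annihilated by `1 - t`. -/
structure MedialData {M : Type*} [AddCommGroup M] [Module Lam M] (N : Submodule Lam M)
    (I : Type*) where
  m : I → M
  X : I → Submodule Lam N
  sub_mem : ∀ i j, m i - m j ∈ N
  ann : ∀ i, ∀ x ∈ X i, (1 - tt) • x = 0

namespace MedialData

variable {M : Type*} [AddCommGroup M] [Module Lam M] {N : Submodule Lam M} {I : Type*}

/-- The underlying set of `Q(N, (mᵢ), (Xᵢ))`: the disjoint union of the quotients `N / Xᵢ`. -/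
def Q (S : MedialData N I) : Type _ := Σ i, N ⧸ S.X i

variable (S : MedialData N I)

/-- The difference `mᵢ - mⱼ`, as an element of `N`. -/
def diff (i j : I) : N := ⟨S.m i - S.m j, S.sub_mem i j⟩

/-- The map `N / Xⱼ → N / Xᵢ`, `y + Xⱼ ↦ (1 - t) y + Xᵢ`. -/
noncomputable def mulOneSub (j i : I) : (N ⧸ S.X j) →ₗ[Lam] (N ⧸ S.X i) :=
  (S.X j).mapQ (S.X i) ((1 - tt) • LinearMap.id) (fun x hx => by
    simp [S.ann j x hx])

/-- The operation `x ▷ y = mⱼ - mᵢ + t x + (1 - t) y + Xᵢ`, for `x` in `N / Xᵢ`, `y` in `N / Xⱼ`. -/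
noncomputable def op (x y : S.Q) : S.Q :=
  ⟨x.1, (S.X x.1).mkQ (S.diff y.1 x.1) + tt • x.2 + S.mulOneSub y.1 x.1 y.2⟩

/-- The inverse operation of `op`. -/
noncomputable def invOp (x y : S.Q) : S.Q :=
  ⟨x.1, (T (-1) : Lam) • (x.2 - (S.X x.1).mkQ (S.diff y.1 x.1) - S.mulOneSub y.1 x.1 y.2)⟩

/-- The element `x + Xᵢ` of `N / Xᵢ`. -/
noncomputable def coset (i : I) (x : N) : S.Q := ⟨i, (S.X i).mkQ x⟩

theorem exists_coset (q : S.Q) : ∃ i x, q = S.coset i x := by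
  obtain ⟨i, x⟩ := q
  obtain ⟨x, rfl⟩ := Submodule.mkQ_surjective _ x
  exact ⟨i, x, rfl⟩

theorem op_coset (i j : I) (x y : N) :
    S.op (S.coset i x) (S.coset j y) = S.coset i (S.diff j i + tt • x + (1 - tt) • y) := rfl

theorem invOp_coset (i j : I) (x y : N) :
    S.invOp (S.coset i x) (S.coset j y) =
      S.coset i ((T (-1) : Lam) • (x - S.diff j i - (1 - tt) • y)) := rfl

noncomputable instance : Quandle S.Q where
  act y x := S.op x y
  invAct y x := S.invOp x y
  self_distrib := by
    intro x y z
    obtain ⟨k, z, rfl⟩ := S.exists_coset z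
    obtain ⟨j, y, rfl⟩ := S.exists_coset y
    obtain ⟨i, x, rfl⟩ := S.exists_coset x
    simp only [op_coset]
    refine congrArg (S.coset k) (Subtype.ext ?_)
    simp only [diff, Submodule.coe_add, Submodule.coe_smul]
    module
  left_inv := by
    intro y x
    obtain ⟨j, y, rfl⟩ := S.exists_coset y
    obtain ⟨i, x, rfl⟩ := S.exists_coset x
    simp only [op_coset, invOp_coset]
    rw [show ∀ p q r : N, p + q + r - p - r = q by intros; abel, smul_smul, ← T_add]
    simp
  right_inv := by
    intro y x
    obtain ⟨j, y, rfl⟩ := S.exists_coset y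
    obtain ⟨i, x, rfl⟩ := S.exists_coset x
    simp only [op_coset, invOp_coset]
    rw [smul_smul, ← T_add]
    rw [add_neg_cancel, T_zero, one_smul]
    exact congrArg _ (by abel)
  fix := by
    intro x
    obtain ⟨i, x, rfl⟩ := S.exists_coset x
    simp only [op_coset]
    refine congrArg (S.coset i) (Subtype.ext ?_)
    simp only [diff, Submodule.coe_add, Submodule.coe_smul]
    module

/-- The quandle `Q(N, (mᵢ), (Xᵢ))` is medial. -/
theorem isAbelian : Rack.IsAbelian S.Q := by
  intro x y z w
  obtain ⟨i, x, rfl⟩ := S.exists_coset x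
  obtain ⟨j, y, rfl⟩ := S.exists_coset y
  obtain ⟨k, z, rfl⟩ := S.exists_coset z
  obtain ⟨l, w, rfl⟩ := S.exists_coset w
  change S.op (S.op _ _) (S.op _ _) = S.op (S.op _ _) (S.op _ _)
  simp only [op_coset]
  refine congrArg (S.coset l) (Subtype.ext ?_)
  simp only [diff, Submodule.coe_add, Submodule.coe_smul]
  module

/-- The data for `Q(N, (d, 0), (X, X))`, where `d` is in `N` and `X` is the submodule of all elements
of `N` annihilated by `1 - t`. -/
noncomputable def pair (N : Submodule Lam M) (d : N) : MedialData N (Fin 2) where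
  m := ![(d : M), 0]
  X := fun _ => Submodule.torsionBy Lam N (1 - tt)
  sub_mem := by
    have h : ∀ i, ![(d : M), 0] i ∈ N := by
      intro i
      fin_cases i <;> simp
    exact fun i j => N.sub_mem (h i) (h j)
  ann := fun _ _ hx => hx

end MedialData

/-- The submodule `(1 - t) N` of a `Λ`-module `N`. -/
noncomputable def oneSubTMul (N : Type*) [AddCommGroup N] [Module Lam N] : Submodule Lam N :=
  LinearMap.range (LinearMap.lsmul Lam N (1 - tt))

/-! Both quandles embed in the Alexander module `M` with the operation `x ▷ y = t x + (1 - t) y`,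
and the embeddings can be chosen with equal images; `ShelfHom.exists_bijective` then gives the
isomorphism.

On one side, `x + Xᵢ ↦ e + mᵢ + (1 - t) x` is injective because `X` is the kernel of `1 - t` on `N`
and `d` is not in `(1 - t) N` (`MedialData.pairToModule_injective`). Its image is the union of `e +
d + (1 - t) N` and `e + (1 - t) N`. On the other side, `q_a ↦ a` has as image the union of the
cosets `a + (1 - t) N`, one for each component (`mem_range_toModule`). The quotient `N / (1 - t) N`
is infinite cyclic, generated by the difference of two arcs `α₁`, `α₂` on different components.
Hence `d` is congruent to that difference after a suitable ordering of the components, and `e = α₂`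
makes the images equal.

The substance is the injectivity of `q_a ↦ a` (`toModule_injective`). The displacements of a medial
quandle form a `Λ`-module, so `M` acts on `MQ(L)` through some `θ`, and every element is `θ(m) q_α`
with `m` in `N`, with image `α + (1 - t) m`. Two elements with the same image therefore differ by
`θ(m)` with `(1 - t) m = 0`. It remains to see that such an `m` fixes every `q_α`. The longitude of
the component of `α` fixes `q_α`, since following the component once around leads back to `q_α`
(`longitude_apply`). For a classical link with two components, every `m` annihilated by `1 - t` is
an integral multiple of either longitude (`exists_zsmul_longitude`). This uses planarity: the
Alexander numbering of the faces gives a linear dependence between the crossing relations, which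
removes the contribution of the other component. -/

/-! ### Augmentation of `Λ` -/

/-- The augmentation `Λ → ℤ`, `t ↦ 1`. -/
noncomputable def aug : Lam →+* ℤ := LaurentPolynomial.eval₂ (RingHom.id ℤ) 1

@[simp] theorem aug_T (n : ℤ) : aug (T n) = 1 := by simp [aug]

@[simp] theorem aug_C (a : ℤ) : aug (C a) = a := by simp [aug]

theorem one_sub_tt_dvd_T_sub_one (n : ℤ) : (1 - tt) ∣ (T n - 1 : Lam) := by
  have key : ∀ m : ℕ, (1 - tt) ∣ (T m - 1 : Lam) := fun m => by
    have h := sub_dvd_pow_sub_pow (1 : Lam) tt m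
    rw [one_pow, tt, T_pow, mul_one] at h
    exact (dvd_sub_comm).mp h
  obtain ⟨m, rfl | rfl⟩ := n.eq_nat_or_neg
  · exact key m
  · have : (T (-m) - 1 : Lam) = -T (-m) * (T m - 1) := by
      rw [mul_sub, neg_mul, ← T_add]
      simp [neg_add_eq_sub]
    rw [this]
    exact (key m).mul_left _

/-- Every power of `t` is congruent to `1` modulo `1 - t`. Hence the kernel of `aug` is generated by
`1 - t`, which justifies each later division by `1 - t`. -/
theorem one_sub_tt_dvd_sub_C_aug (p : Lam) : (1 - tt) ∣ p - C (aug p) := by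
  induction p using LaurentPolynomial.induction_on' with
  | add p q hp hq =>
    rw [map_add, map_add, add_sub_add_comm]
    exact dvd_add hp hq
  | C_mul_T n a =>
    rw [map_mul, aug_T, aug_C, mul_one, ← mul_sub_one]
    exact (one_sub_tt_dvd_T_sub_one n).mul_left _

theorem one_sub_tt_dvd_of_aug_eq_zero {p : Lam} (h : aug p = 0) : (1 - tt) ∣ p := by
  simpa [h] using one_sub_tt_dvd_sub_C_aug p

theorem one_sub_tt_ne_zero : (1 - tt : Lam) ≠ 0 := by
  intro h
  have := congrArg (fun p : Lam => p.coeff 0) h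
  rw [← T_zero] at this
  simp [-T_zero] at this

/-- An additive subgroup of a `Λ`-module that is stable under `t` and `t⁻¹` is a submodule. -/
def AddSubgroup.toLamSubmodule {M : Type*} [AddCommGroup M] [Module Lam M] (H : AddSubgroup M)
    (h₁ : ∀ m ∈ H, (T 1 : Lam) • m ∈ H) (h₂ : ∀ m ∈ H, (T (-1) : Lam) • m ∈ H) :
    Submodule Lam M where
  toAddSubmonoid := H.toAddSubmonoid
  smul_mem' := by
    intro p m hm
    change p • m ∈ H
    replace hm : m ∈ H := hm
    induction p using LaurentPolynomial.induction_on' generalizing m with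
    | add p q hp hq =>
      rw [add_smul]
      exact H.add_mem (hp hm) (hq hm)
    | C_mul_T n a =>
      have hT : (T n : Lam) • m ∈ H := by
        induction n using Int.induction_on with
        | zero => simpa using hm
        | succ n ih =>
          rw [add_comm, T_add, mul_smul]
          exact h₁ _ ih
        | pred n ih =>
          rw [sub_eq_add_neg, add_comm, T_add, mul_smul]
          exact h₂ _ ih
      have : (C a * T n : Lam) • m = a • ((T n : Lam) • m) := by
        rw [← smul_eq_C_mul, smul_assoc]
      rw [this]
      exact H.zsmul_mem hT a

/-! ### Displacements of a medial quandle -/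

namespace Quandle

universe u

variable {Q : Type u} [Quandle Q]

theorem act'_invAct (x y : Q) :
    Rack.act' (x ◃⁻¹ y) = (Rack.act' x)⁻¹ * Rack.act' y * Rack.act' x := by
  have h := Rack.ad_conj x (x ◃⁻¹ y)
  rw [Rack.right_inv] at h
  rw [h]
  group

/-- Mediality equates the translations by `x ◃ y` after `z` and by `x ◃ z` after `y`; expanding both
as conjugates and cancelling the translation by `x` leaves the claim. It makes the displacements
commute. -/
theorem act'_mul_inv_mul (hQ : Rack.IsAbelian Q) (x y z : Q) :
    Rack.act' y * (Rack.act' x)⁻¹ * Rack.act' z = Rack.act' z * (Rack.act' x)⁻¹ * Rack.act' y := by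
  have h : Rack.act' (x ◃ y) * Rack.act' z = Rack.act' (x ◃ z) * Rack.act' y :=
    Equiv.ext fun w => hQ x y z w
  rw [Rack.ad_conj, Rack.ad_conj] at h
  simpa only [mul_assoc, mul_right_inj] using h

variable (Q) in
/-- The displacement group of a quandle. -/
def displacement : Subgroup (Equiv.Perm Q) :=
  Subgroup.closure {g | ∃ y z : Q, g = Rack.act' y * (Rack.act' z)⁻¹}

theorem act'_mul_inv_mem_displacement (y z : Q) :
    Rack.act' y * (Rack.act' z)⁻¹ ∈ displacement Q :=
  Subgroup.subset_closure ⟨y, z, rfl⟩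

theorem displacement_mul_comm (hQ : Rack.IsAbelian Q) (g h : displacement Q) : g * h = h * g := by
  have key := Subgroup.isMulCommutative_closure
    (k := {g | ∃ y z : Q, g = Rack.act' y * (Rack.act' z)⁻¹}) (by
      rintro _ ⟨y, z, rfl⟩ _ ⟨x, w, rfl⟩
      have h₁ := act'_mul_inv_mul hQ z y x
      have h₂ := congrArg (fun g => g⁻¹) (act'_mul_inv_mul hQ y z w)
      simp only [mul_inv_rev, inv_inv] at h₂
      calc _ = Rack.act' y * (Rack.act' z)⁻¹ * Rack.act' x * (Rack.act' w)⁻¹ := by group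
        _ = Rack.act' x * ((Rack.act' z)⁻¹ * (Rack.act' y * (Rack.act' w)⁻¹)) := by rw [h₁]; group
        _ = _ := by rw [← h₂]; group)
  exact key.is_comm.comm g h

theorem conj_mem_displacement (x : Q) {g : Equiv.Perm Q} (hg : g ∈ displacement Q) :
    Rack.act' x * g * (Rack.act' x)⁻¹ ∈ displacement Q := by
  induction hg using Subgroup.closure_induction with
  | mem g hg =>
    obtain ⟨y, z, rfl⟩ := hg
    convert act'_mul_inv_mem_displacement (x ◃ y) (x ◃ z) using 1
    rw [Rack.ad_conj, Rack.ad_conj]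
    group
  | one => simp [one_mem]
  | mul g h _ _ hg hh =>
    convert mul_mem hg hh using 1
    group
  | inv g _ hg =>
    convert inv_mem hg using 1
    group

theorem conj_inv_mem_displacement (x : Q) {g : Equiv.Perm Q} (hg : g ∈ displacement Q) :
    (Rack.act' x)⁻¹ * g * Rack.act' x ∈ displacement Q := by
  induction hg using Subgroup.closure_induction with
  | mem g hg =>
    obtain ⟨y, z, rfl⟩ := hg
    convert act'_mul_inv_mem_displacement (x ◃⁻¹ y) (x ◃⁻¹ z) using 1
    rw [act'_invAct, act'_invAct]
    group
  | one => simp [one_mem]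
  | mul g h _ _ hg hh =>
    convert mul_mem hg hh using 1
    group
  | inv g _ hg =>
    convert inv_mem hg using 1
    group

/-- The displacements of a medial quandle form a `Λ`-module, in which `t` acts as conjugation by a
fixed translation. -/
theorem exists_module_displacement (hQ : Rack.IsAbelian Q) (x : Q) :
    ∃ (E : Type u) (_ : AddCommGroup E) (_ : Module Lam E) (ι : Multiplicative E →* Equiv.Perm Q),
      (∀ y, ∃ e : E, ι (.ofAdd e) = Rack.act' y * (Rack.act' x)⁻¹) ∧ Function.Injective ι ∧
      ∀ e : E, ι (.ofAdd (tt • e)) = Rack.act' x * ι (.ofAdd e) * (Rack.act' x)⁻¹ := by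
  let G := displacement Q
  let : CommGroup G := { (inferInstance : Group G) with mul_comm := displacement_mul_comm hQ }
  let f : AddMonoid.End (Additive G) :=
    { toFun := fun g => Additive.ofMul ⟨_, conj_mem_displacement x g.toMul.2⟩
      map_zero' := Additive.toMul.injective (Subtype.ext (by simp))
      map_add' := fun g h => Additive.toMul.injective (Subtype.ext (by simp)) }
  let f' : AddMonoid.End (Additive G) :=
    { toFun := fun g => Additive.ofMul ⟨_, conj_inv_mem_displacement x g.toMul.2⟩
      map_zero' := Additive.toMul.injective (Subtype.ext (by simp))
      map_add' := fun g h => Additive.toMul.injective (Subtype.ext (by simp [mul_assoc])) }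
  let u : (AddMonoid.End (Additive G))ˣ :=
    { val := f
      inv := f'
      val_inv := AddMonoidHom.ext fun g => Additive.toMul.injective (Subtype.ext (by
        change Rack.act' x * ((Rack.act' x)⁻¹ * (g.toMul : Equiv.Perm Q) * Rack.act' x) *
          (Rack.act' x)⁻¹ = g.toMul
        group))
      inv_val := AddMonoidHom.ext fun g => Additive.toMul.injective (Subtype.ext (by
        change (Rack.act' x)⁻¹ * (Rack.act' x * (g.toMul : Equiv.Perm Q) * (Rack.act' x)⁻¹) *
          Rack.act' x = g.toMul
        group)) }
  let φ : Lam →ₐ[ℤ] AddMonoid.End (Additive G) :=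
    AddMonoidAlgebra.lift ℤ (AddMonoid.End (Additive G)) ℤ
      ((Units.coeHom _).comp (zpowersHom _ u))
  have hφ : φ tt = f := by
    refine (AddMonoidAlgebra.lift_single _ _ _).trans ?_
    simp [u]
  let : Module Lam (Additive G) := Module.compHom _ (φ : Lam →+* AddMonoid.End (Additive G))
  refine ⟨Additive G, inferInstance, inferInstance, 
    { toFun := fun g => (g.toAdd.toMul : G)
      map_one' := rfl
      map_mul' := fun _ _ => rfl }, fun y =>
      ⟨Additive.ofMul ⟨_, act'_mul_inv_mem_displacement y x⟩, rfl⟩, G.subtype_injective, fun e => ?_⟩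
  have : tt • e = f e := by
    change φ tt e = f e
    rw [hφ]
  rw [this]
  rfl

end Quandle

/-! ### Functions constant along a relation -/

/-- The functions that are constant along a relation. -/
def constantAlong {H : Type*} (r : H → H → Prop) : Submodule ℝ (EuclideanSpace ℝ H) where
  carrier := {f | ∀ h h', r h h' → f h = f h'}
  add_mem' := fun hf hg h h' hr => by simp [hf h h' hr, hg h h' hr]
  zero_mem' := fun _ _ _ => rfl
  smul_mem' := fun a f hf h h' hr => by simp [hf h h' hr]

theorem finrank_constantAlong {H : Type*} [Finite H] (r : H → H → Prop) :
    Module.finrank ℝ (constantAlong r) = Nat.card (Quot r) := by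
  have := Fintype.ofFinite (Quot r)
  let e : (Quot r → ℝ) ≃ₗ[ℝ] constantAlong r :=
    { toFun := fun f => ⟨WithLp.toLp 2 fun h => f (Quot.mk r h), fun h h' hr => by
        simp [Quot.sound hr]⟩
      map_add' := fun _ _ => rfl
      map_smul' := fun _ _ => rfl
      invFun := fun f => Quot.lift f.1 f.2
      left_inv := fun f => by
        ext x
        induction x using Quot.ind
        rfl
      right_inv := fun f => rfl }
  rw [← e.finrank_eq, Module.finrank_fintype_fun_eq_card, Nat.card_eq_fintype_card]

/-! ### Planarity: the Alexander numbering and the dependence of the crossing relations -/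

namespace LinkDiagram

variable (D : LinkDiagram)

/-- The sign of a half-edge: `1` if it points away from the crossing, `-1` otherwise. -/
def sgn (h : D.HalfEdge) : ℤ := if halfEdgeOut D.positive h then 1 else -1

theorem sgn_opp (h : D.HalfEdge) : D.sgn (D.opp h) = -D.sgn h := by
  unfold sgn
  rw [D.out_opp]
  cases halfEdgeOut D.positive h <;> rfl

@[simp] theorem sgn_zero (c : D.Crossing) : D.sgn (c, 0) = 1 := rfl

@[simp] theorem sgn_two (c : D.Crossing) : D.sgn (c, 2) = -1 := rfl

theorem sgn_one (c : D.Crossing) : D.sgn (c, 1) = if D.positive c then 1 else -1 := rfl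

@[simp] theorem sgn_three (c : D.Crossing) : D.sgn (c, 3) = -D.sgn (c, 1) := by
  have h : D.sgn (c, 3) = if !(D.positive c) then 1 else -1 := rfl
  rw [h, sgn_one]
  cases D.positive c <;> rfl

theorem opp_ne (h : D.HalfEdge) : D.opp h ≠ h := fun e => by
  have := D.out_opp h
  rw [e] at this
  simp at this

theorem sum_eq_zero_of_opp {A : Type*} [AddCommGroup A] (g : D.HalfEdge → A)
    (hg : ∀ h, g (D.opp h) = -g h) : ∑ h, g h = 0 :=
  Finset.sum_involution (fun h _ => D.opp h) (fun h _ => by simp [hg]) (fun h _ _ => D.opp_ne h)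
    (fun _ _ => Finset.mem_univ _) (fun h _ => D.opp_opp h)

theorem sum_halfEdge {A : Type*} [AddCommMonoid A] (g : D.HalfEdge → A) :
    ∑ h, g h = ∑ c, (g (c, 0) + g (c, 1) + g (c, 2) + g (c, 3)) := by
  rw [Fintype.sum_prod_type]
  exact Finset.sum_congr rfl fun c _ => Fin.sum_univ_four _

/-- Each crossing has exactly two outgoing half-edges, and each edge has exactly one outgoing end,
recovered by `g`. -/
theorem two_mul_n_le_card_quot_opp :
    2 * D.n ≤ Nat.card (Quot fun h h' : D.HalfEdge => h' = D.opp h) := by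
  let e : D.Crossing × Bool → D.HalfEdge := fun x =>
    if x.2 then (x.1, 0) else (x.1, if D.positive x.1 then 1 else 3)
  have he : ∀ x, halfEdgeOut D.positive (e x) = true := by
    rintro ⟨c, _ | _⟩
    · cases h : D.positive c <;> simp [e, h, halfEdgeOut]
    · rfl
  have he' : Function.Injective e := by
    rintro ⟨c, _ | _⟩ ⟨c', _ | _⟩ h
    · simpa [e] using (congrArg Prod.fst h)
    · have h₁ := congrArg Prod.fst h
      have h₂ := congrArg Prod.snd h
      cases hp : D.positive c <;> simp [e, hp] at h₂
    · have h₁ := congrArg Prod.fst h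
      have h₂ := congrArg Prod.snd h
      cases hp : D.positive c' <;> simp [e, hp] at h₂
    · simpa [e] using (congrArg Prod.fst h)
  let g : (Quot fun h h' : D.HalfEdge => h' = D.opp h) → D.HalfEdge :=
    Quot.lift (fun h => if halfEdgeOut D.positive h then h else D.opp h) (by
      rintro h _ rfl
      have := D.out_opp h
      cases h' : halfEdgeOut D.positive h <;> simp [h', D.opp_opp] at this ⊢ <;> simp [this])
  have hinj : Function.Injective fun x => Quot.mk (fun h h' : D.HalfEdge => h' = D.opp h) (e x) := by
    intro x y hxy
    have : g (Quot.mk _ (e x)) = g (Quot.mk _ (e y)) := congrArg g hxy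
    simp only [g, he, if_true] at this
    exact he' this
  have := Nat.card_le_card_of_injective _ hinj
  simpa [mul_comm] using this

theorem n_le_card_quot_rot : D.n ≤ Nat.card (Quot fun h h' : D.HalfEdge => h' = D.rot h) := by
  have hinj : Function.Injective fun c : D.Crossing =>
      Quot.mk (fun h h' : D.HalfEdge => h' = D.rot h) (c, 0) := by
    intro c c' h
    exact congrArg (Quot.lift (fun h : D.HalfEdge => h.1) (by rintro h _ rfl; rfl)) h
  simpa using Nat.card_le_card_of_injective _ hinj

theorem rot_bijective : Function.Bijective D.rot := by
  refine (Finite.injective_iff_bijective).mp fun h h' e => ?_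
  simp only [rot, Prod.mk.injEq, add_left_inj] at e
  exact Prod.ext e.1 e.2

/-- The coboundary of a function on the half-edges. -/
noncomputable def coboundary : EuclideanSpace ℝ D.HalfEdge →ₗ[ℝ] EuclideanSpace ℝ D.HalfEdge where
  toFun f := WithLp.toLp 2 fun h => f h - f (D.opp h)
  map_add' f g := by
    ext h
    simp
    ring
  map_smul' a f := by
    ext h
    simp
    ring

theorem constantAlong_opp_inf_rot :
    constantAlong (fun h h' : D.HalfEdge => h' = D.opp h) ⊓
      constantAlong (fun h h' : D.HalfEdge => h' = D.rot h) = constantAlong D.PieceStep := by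
  ext f
  constructor
  · rintro ⟨h₁, h₂⟩ h _ (_ | _)
    · exact h₁ _ _ rfl
    · exact h₂ _ _ rfl
  · refine fun hf => ⟨?_, ?_⟩
    · rintro h _ rfl
      exact hf _ _ (.edge h)
    · rintro h _ rfl
      exact hf _ _ (.turn h)

theorem mem_orthogonal_opp {s : EuclideanSpace ℝ D.HalfEdge} (hs : ∀ h, s (D.opp h) = -s h) :
    s ∈ (constantAlong (fun h h' : D.HalfEdge => h' = D.opp h))ᗮ := by
  rw [Submodule.mem_orthogonal']
  intro f hf
  rw [PiLp.inner_apply]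
  refine D.sum_eq_zero_of_opp _ fun h => ?_
  simp [hs, ← hf h _ rfl]

theorem face_opp {f : EuclideanSpace ℝ D.HalfEdge}
    (hf : f ∈ constantAlong (fun h h' : D.HalfEdge => h' = D.rot (D.opp h))) (h : D.HalfEdge) :
    f (D.opp h) = f (D.rot h) := by
  have := hf (D.opp h) _ rfl
  rwa [D.opp_opp] at this

/-- The right side consists of the flows: antisymmetric along edges, with sum zero at each crossing.
Coboundaries of face functions are flows, and on spheres these are all. Dimensions decide: with `P`
pieces, flows have dimension at most `4n - (2n + n - P) = n + P`. A face function with zero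
coboundary is constant on pieces, so the image has dimension at least `F - P`, which is `n + P` by
Euler's formula. -/
theorem map_coboundary (hD : D.IsClassical) :
    (constantAlong (fun h h' : D.HalfEdge => h' = D.rot (D.opp h))).map D.coboundary =
      (constantAlong (fun h h' : D.HalfEdge => h' = D.opp h) ⊔
        constantAlong (fun h h' : D.HalfEdge => h' = D.rot h))ᗮ := by
  apply Submodule.eq_of_le_of_finrank_le
  · rintro _ ⟨f, hf, rfl⟩
    rw [← Submodule.inf_orthogonal]
    refine ⟨D.mem_orthogonal_opp fun h => ?_, ?_⟩
    · simp [coboundary, D.opp_opp]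
    · rw [SetLike.mem_coe, Submodule.mem_orthogonal']
      intro g hg
      rw [PiLp.inner_apply]
      have := (Equiv.ofBijective _ D.rot_bijective).sum_comp fun h => g h * f h
      simp only [Equiv.ofBijective_apply] at this
      simp only [coboundary, LinearMap.coe_mk, AddHom.coe_mk, D.face_opp hf]
      simp only [RCLike.inner_apply, conj_trivial, mul_sub, Finset.sum_sub_distrib]
      rw [← this, sub_eq_zero]
      exact Finset.sum_congr rfl fun h _ => by rw [hg h _ rfl]
  · have h₁ := Submodule.finrank_add_finrank_orthogonal
      (constantAlong (fun h h' : D.HalfEdge => h' = D.opp h) ⊔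
        constantAlong (fun h h' : D.HalfEdge => h' = D.rot h))
    have h₂ := Submodule.finrank_sup_add_finrank_inf_eq
      (constantAlong (fun h h' : D.HalfEdge => h' = D.opp h))
      (constantAlong (fun h h' : D.HalfEdge => h' = D.rot h))
    have h₃ := LinearMap.finrank_range_add_finrank_ker (D.coboundary.domRestrict
      (constantAlong (fun h h' : D.HalfEdge => h' = D.rot (D.opp h))))
    have h₄ : Module.finrank ℝ (LinearMap.ker (D.coboundary.domRestrict
        (constantAlong (fun h h' : D.HalfEdge => h' = D.rot (D.opp h))))) ≤
          Module.finrank ℝ (constantAlong D.PieceStep) := by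
      rw [← Submodule.finrank_map_subtype_eq]
      apply Submodule.finrank_mono
      rintro _ ⟨⟨f, hf⟩, hf', rfl⟩
      have key : ∀ h, f h = f (D.opp h) := fun h => by
        have := congrArg (fun g : EuclideanSpace ℝ D.HalfEdge => g h) hf'
        simpa [coboundary, sub_eq_zero] using this
      rintro h _ (_ | _)
      · exact key h
      · exact (key h).trans (D.face_opp hf h)
    rw [LinearMap.range_domRestrict] at h₃
    rw [D.constantAlong_opp_inf_rot] at h₂
    simp only [finrank_constantAlong, finrank_euclideanSpace, Fintype.card_prod,
      Fintype.card_fin] at h₁ h₂ h₃ h₄ ⊢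
    have h₅ := D.two_mul_n_le_card_quot_opp
    have h₆ := D.n_le_card_quot_rot
    unfold IsClassical Face Piece at hD
    omega

/-- The Alexander numbering of the faces of a classical diagram. -/
theorem exists_alexanderNumbering (hD : D.IsClassical) :
    ∃ U : D.HalfEdge → ℤ, (∀ h, U h - U (D.opp h) = D.sgn h) ∧ ∀ h, U (D.opp h) = U (D.rot h) := by
  have hs : (WithLp.toLp 2 fun h => (D.sgn h : ℝ)) ∈
      (constantAlong (fun h h' : D.HalfEdge => h' = D.rot (D.opp h))).map D.coboundary := by
    rw [D.map_coboundary hD, ← Submodule.inf_orthogonal]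
    refine ⟨D.mem_orthogonal_opp fun h => by simp [sgn_opp], ?_⟩
    rw [SetLike.mem_coe, Submodule.mem_orthogonal']
    intro g hg
    rw [PiLp.inner_apply, sum_halfEdge]
    refine Finset.sum_eq_zero fun c _ => ?_
    have h₁ : g (c, 0) = g (c, 1) := hg _ _ rfl
    have h₂ : g (c, 1) = g (c, 2) := hg _ _ rfl
    have h₃ : g (c, 2) = g (c, 3) := hg _ _ rfl
    simp [h₁, h₂, h₃]
  obtain ⟨f, hf, hfs⟩ := hs
  -- The real solution `f` has integral jumps across the edges, so rounding down preserves them.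
  refine ⟨fun h => ⌊f h⌋, fun h => ?_, fun h => congrArg Int.floor (D.face_opp hf h)⟩
  have := congrArg (fun g : EuclideanSpace ℝ D.HalfEdge => g h) hfs
  simp only [coboundary, LinearMap.coe_mk, AddHom.coe_mk] at this
  change ⌊f h⌋ - ⌊f (D.opp h)⌋ = _
  rw [sub_eq_iff_eq_add'.mp this, Int.floor_add_intCast]
  ring

theorem arcOf_opp (h : D.HalfEdge) : D.arcOf (D.opp h) = D.arcOf h :=
  congrArg Sum.inl (Quot.sound (.edge h)).symm

theorem arcOf_two (c : D.Crossing) : D.arcOf (c, 2) = D.a c :=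
  congrArg Sum.inl (Quot.sound (.overpass c)).symm

theorem rhoRed_apply (w : D.Crossing →₀ Lam) :
    D.rhoRed w = ∑ c, w c • ((1 - tt) • Finsupp.single (D.a c) (1 : Lam) +
      tt • Finsupp.single (D.b₁ c) 1 - Finsupp.single (D.b₂ c) 1) := by
  rw [rhoRed, Finsupp.linearCombination_apply, Finsupp.sum_fintype]
  simp

/-- The relations of the Alexander module of a classical diagram are linearly dependent. -/
theorem exists_rhoRed_eq_zero (hD : D.IsClassical) :
    ∃ r : D.Crossing →₀ Lam, D.rhoRed r = 0 ∧ ∀ c, aug (r c) = D.sgn (c, 1) := by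
  obtain ⟨U, hU, hU'⟩ := D.exists_alexanderNumbering hD
  -- `R` labels an edge by the number of the face on a fixed side of it, read at its outgoing end.
  let R : D.HalfEdge → ℤ := fun h => if halfEdgeOut D.positive h then U h else U (D.opp h)
  have hR : ∀ h, R (D.opp h) = R h := fun h => by
    have := D.out_opp h
    cases h' : halfEdgeOut D.positive h <;> simp [R, h', this, D.opp_opp]
  refine ⟨Finsupp.equivFunOnFinite.symm fun c => if D.positive c then T (U (c, 0) - 1)
    else -T (U (c, 0)), ?_, fun c => ?_⟩
  -- The two ends of an edge contribute opposite terms, so the total is zero. Grouped by crossings,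
  -- the four terms at `c` add up to minus the coefficient of `c` times its relation.
  · have key := D.sum_eq_zero_of_opp
      (fun h => (D.sgn h) • (T (R h) : Lam) • Finsupp.single (D.arcOf h) (1 : Lam))
      (fun h => by rw [sgn_opp, hR, arcOf_opp, neg_smul])
    rw [sum_halfEdge] at key
    rw [rhoRed_apply, ← neg_eq_zero, ← key, ← Finset.sum_neg_distrib]
    refine Finset.sum_congr rfl fun c _ => ?_
    have e₀ := hU (c, 0)
    have e₁ := hU (c, 1)
    have e₂ := hU (c, 2)
    have e₃ := hU (c, 3)
    rw [hU'] at e₀ e₁ e₂ e₃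
    change U (c, 0) - U (c, 1) = _ at e₀
    change U (c, 1) - U (c, 2) = _ at e₁
    change U (c, 2) - U (c, 3) = _ at e₂
    change U (c, 3) - U (c, 0) = _ at e₃
    have f₁ := hU' (c, 1)
    have f₂ := hU' (c, 2)
    have f₃ := hU' (c, 3)
    change _ = U (c, 2) at f₁
    change _ = U (c, 3) at f₂
    change _ = U (c, 0) at f₃
    simp only [sgn_zero, sgn_two, sgn_three, sgn_one] at e₀ e₁ e₂ e₃ ⊢
    rw [arcOf_two]
    change _ = _ + _ • _ • Finsupp.single (D.b₂ c) _ + _ + _ • _ • Finsupp.single (D.b₁ c) _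
    change _ = _ • _ • Finsupp.single (D.a c) _ + _ + _ + _
    have hT : (T (U (c, 0)) : Lam) = tt * T (U (c, 0) - 1) := by rw [tt, ← T_add]; congr 1; ring
    have hT' : (T (U (c, 0) + 1) : Lam) = tt * T (U (c, 0)) := by rw [tt, ← T_add]; congr 1; ring
    cases hp : D.positive c
    · simp only [hp, Bool.false_eq_true, if_false] at e₀ e₁ e₂ e₃
      have g₀ : R (c, 0) = U (c, 0) := rfl
      have g₁ : R (c, 1) = U (c, 0) := by simp [R, halfEdgeOut, hp, f₁]; lia
      have g₂ : R (c, 2) = U (c, 0) + 1 := by simp [R, halfEdgeOut, f₂]; lia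
      have g₃ : R (c, 3) = U (c, 0) + 1 := by simp [R, halfEdgeOut, hp]; lia
      rw [g₀, g₁, g₂, g₃, hT']
      simp only [hp, Finsupp.equivFunOnFinite_symm_apply_apply, Bool.false_eq_true, if_false]
      module
    · simp only [hp, if_true] at e₀ e₁ e₂ e₃
      have g₀ : R (c, 0) = U (c, 0) := rfl
      have g₁ : R (c, 1) = U (c, 0) - 1 := by simp [R, halfEdgeOut, hp]; lia
      have g₂ : R (c, 2) = U (c, 0) - 1 := by simp [R, halfEdgeOut, f₂]; lia
      have g₃ : R (c, 3) = U (c, 0) := by simp [R, halfEdgeOut, hp, f₃]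
      rw [g₀, g₁, g₂, g₃, hT]
      simp only [hp, Finsupp.equivFunOnFinite_symm_apply_apply, if_true]
      module
  · rw [sgn_one]
    cases hp : D.positive c <;> simp [hp]

end LinkDiagram

namespace LinkDiagram

variable (D : LinkDiagram)

/-! ### Components -/

/-- The component that contains a given half-edge. -/
def componentOfHalfEdge (h : D.HalfEdge) : D.Component := Sum.inl (Quot.mk _ h)

theorem componentOfHalfEdge_opp (h : D.HalfEdge) :
    D.componentOfHalfEdge (D.opp h) = D.componentOfHalfEdge h :=
  congrArg Sum.inl (Quot.sound (.edge h)).symm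

theorem componentOfHalfEdge_rot_rot (h : D.HalfEdge) :
    D.componentOfHalfEdge (D.rot (D.rot h)) = D.componentOfHalfEdge h :=
  congrArg Sum.inl (Quot.sound (.through h)).symm

/-- The component that contains a given arc. -/
def componentOf : D.Arc → D.Component :=
  Sum.elim (Quot.lift D.componentOfHalfEdge (by
    rintro h _ (_ | c)
    · exact (D.componentOfHalfEdge_opp h).symm
    · exact (D.componentOfHalfEdge_rot_rot (c, 0)).symm)) Sum.inr

theorem componentOf_surjective : Function.Surjective D.componentOf := by
  rintro (⟨⟨h⟩⟩ | i)
  · exact ⟨D.arcOf h, rfl⟩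
  · exact ⟨Sum.inr i, rfl⟩

/-- The component of the underpassing strand at a crossing. -/
def underComponent (c : D.Crossing) : D.Component := D.componentOf (D.b₁ c)

theorem componentOf_b₂ (c : D.Crossing) : D.componentOf (D.b₂ c) = D.underComponent c :=
  (D.componentOfHalfEdge_rot_rot (c, 1)).symm

/-- Arcs on the same component are joined by a sequence of underpasses. -/
theorem rel_of_componentOf_eq (s : Setoid D.Arc) (hs : ∀ c, s (D.b₁ c) (D.b₂ c))
    {α α' : D.Arc} (h : D.componentOf α = D.componentOf α') : s α α' := by
  let F : D.Component → Quotient s :=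
    Sum.elim (Quot.lift (fun h => ⟦D.arcOf h⟧) (by
      rintro ⟨c, k⟩ _ (_ | _)
      · exact congrArg _ (D.arcOf_opp (c, k)).symm
      · fin_cases k
        · exact congrArg _ (D.arcOf_two c).symm
        · exact Quotient.sound (s.symm (hs c))
        · have h : D.rot (D.rot (c, 2)) = (c, 0) := Prod.ext rfl (by decide : (2 : Fin 4) + 1 + 1 = 0)
          change ⟦D.arcOf (c, 2)⟧ = (⟦D.arcOf (D.rot (D.rot (c, 2)))⟧ : Quotient s)
          rw [h, arcOf_two]
          rfl
        · exact Quotient.sound (hs c))) (fun i => ⟦Sum.inr i⟧)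
  have hF : ∀ α, F (D.componentOf α) = ⟦α⟧ := by
    rintro (⟨⟨h⟩⟩ | i) <;> rfl
  exact Quotient.exact ((hF α).symm.trans ((congrArg F h).trans (hF α')))

open Classical in
/-- The signed underpasses of a component, as a cellular `1`-cycle of the graph whose vertices are
the arcs, and whose edges are the crossings. -/
noncomputable def underCycle (i : D.Component) (c : D.Crossing) : ℤ :=
  if D.underComponent c = i then D.sgn (c, 1) else 0

/-- A telescoping sum along the component. The signed values of `p` at the half-edges cancel along
edges; at a crossing the two overpassing ends lie on one arc and cancel too, so only the underpasses
remain. -/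
theorem sum_underCycle {A : Type*} [AddCommGroup A] (i : D.Component) (p : D.Arc → A) :
    ∑ c, D.underCycle i c • (p (D.b₂ c) - p (D.b₁ c)) = 0 := by
  classical
  have key := D.sum_eq_zero_of_opp
    (fun h => if D.componentOfHalfEdge h = i then D.sgn h • p (D.arcOf h) else 0) (fun h => by
      simp only [componentOfHalfEdge_opp, sgn_opp, arcOf_opp, neg_smul]
      split_ifs <;> simp)
  rw [sum_halfEdge] at key
  rw [← key]
  refine Finset.sum_congr rfl fun c _ => ?_
  have h₀ : D.componentOfHalfEdge (c, 2) = D.componentOfHalfEdge (c, 0) :=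
    D.componentOfHalfEdge_rot_rot (c, 0)
  have h₁ : D.componentOfHalfEdge (c, 1) = D.underComponent c := D.componentOf_b₂ c
  have h₃ : D.componentOfHalfEdge (c, 3) = D.underComponent c := rfl
  have a₁ : D.arcOf (c, 1) = D.b₂ c := rfl
  have a₃ : D.arcOf (c, 3) = D.b₁ c := rfl
  have a₀ : D.arcOf (c, 0) = D.a c := rfl
  rw [h₀, h₁, h₃, a₁, a₃, a₀, arcOf_two, sgn_three, sgn_zero, sgn_two, underCycle]
  split_ifs <;> simp only [smul_sub, neg_smul, one_smul, zero_smul] <;> abel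

/-- The `1`-cycles of the graph whose vertices are the arcs, and whose edges are the crossings. -/
theorem exists_eq_of_sum_eq_zero (w : D.Crossing → ℤ)
    (hw : ∑ c, w c • (Finsupp.single (D.b₁ c) (1 : ℤ) - Finsupp.single (D.b₂ c) 1) = 0) :
    ∃ g : D.Component → ℤ, ∀ c, w c = D.sgn (c, 1) * g (D.underComponent c) := by
  classical
  -- Modulo `S`, half-edges on the same arc become equal, so the hypothesis can be transported to
  -- the quotient. Membership in `S` then supplies a flow `f` on the edges which has the values `∓ w
  -- c` at the underpassing ends and continues unchanged through overpasses.
  let S : AddSubgroup (D.HalfEdge → ℤ) :=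
    { carrier := {s | ∃ f : D.HalfEdge → ℤ, (∀ h, f (D.opp h) = -f h) ∧
        ∀ c, f (c, 1) = s (c, 1) ∧ f (c, 3) = s (c, 3) ∧ f (c, 0) + f (c, 2) = s (c, 0) + s (c, 2)}
      add_mem' := by
        rintro s s' ⟨f, hf, hs⟩ ⟨f', hf', hs'⟩
        refine ⟨f + f', fun h => ?_, fun c => ?_⟩
        · simp only [Pi.add_apply, hf, hf']
          ring
        · simp only [Pi.add_apply]
          have := hs c
          have := hs' c
          lia
      zero_mem' := ⟨0, by simp, by simp⟩
      neg_mem' := by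
        rintro s ⟨f, hf, hs⟩
        refine ⟨-f, fun h => by simp [hf], fun c => ?_⟩
        simp only [Pi.neg_apply]
        have := hs c
        lia }
  let P : D.Arc → (D.HalfEdge → ℤ) ⧸ S := Sum.elim
    (Quot.lift (fun h => QuotientAddGroup.mk (Pi.single h 1)) (by
      rintro h _ (_ | c)
      · rw [QuotientAddGroup.eq]
        refine ⟨-Pi.single h 1 + Pi.single (D.opp h) 1, fun h' => ?_, fun c => ⟨rfl, rfl, rfl⟩⟩
        have e₁ : D.opp h' = h ↔ h' = D.opp h := by
          constructor
          · rintro rfl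
            rw [D.opp_opp]
          · rintro rfl
            rw [D.opp_opp]
        have e₂ : D.opp h' = D.opp h ↔ h' = h :=
          (Function.LeftInverse.injective D.opp_opp).eq_iff
        simp only [Pi.add_apply, Pi.neg_apply, Pi.single_apply, e₁, e₂]
        ring
      · rw [QuotientAddGroup.eq]
        refine ⟨0, by simp, fun c' => ?_⟩
        simp [Pi.single_apply])) 0
  have hP : ∀ h, P (D.arcOf h) = QuotientAddGroup.mk (Pi.single h 1) := fun h => rfl
  have key := congrArg (Finsupp.linearCombination ℤ P) hw
  simp only [map_sum, map_smul, map_sub, Finsupp.linearCombination_single, one_smul, map_zero,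
    b₁, b₂, hP] at key
  simp only [← QuotientAddGroup.mk_sub, ← QuotientAddGroup.mk_zsmul] at key
  rw [← QuotientAddGroup.mk_sum, QuotientAddGroup.eq_zero_iff] at key
  obtain ⟨f, hf, hs⟩ := key
  have hs' : ∀ c, f (c, 1) = -w c ∧ f (c, 3) = w c ∧ f (c, 0) + f (c, 2) = 0 := fun c => by
    simpa [Finset.sum_apply, Pi.single_apply] using hs c
  -- Corrected by the orientation sign, the flow is constant along each component. Components
  -- without crossings get the irrelevant value `0`.
  let g : D.Component → ℤ := Sum.elim (Quot.lift (fun h => -(D.sgn h * f h)) (by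
    rintro ⟨c, k⟩ _ (_ | _)
    · simp [sgn_opp, hf]
    · obtain ⟨h₁, h₃, h₀⟩ := hs' c
      fin_cases k
      · change -(D.sgn (c, 0) * f (c, 0)) = -(D.sgn (c, 2) * f (c, 2))
        simp
        lia
      · change -(D.sgn (c, 1) * f (c, 1)) = -(D.sgn (c, 3) * f (c, 3))
        simp [h₁, h₃]
      · have h : D.rot (D.rot (c, 2)) = (c, 0) := Prod.ext rfl (by decide : (2 : Fin 4) + 1 + 1 = 0)
        change -(D.sgn (c, 2) * f (c, 2)) =
          -(D.sgn (D.rot (D.rot (c, 2))) * f (D.rot (D.rot (c, 2))))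
        rw [h]
        simp
        lia
      · change -(D.sgn (c, 3) * f (c, 3)) = -(D.sgn (c, 1) * f (c, 1))
        simp [h₁, h₃])) 0
  refine ⟨g, fun c => ?_⟩
  change w c = D.sgn (c, 1) * -(D.sgn (c, 3) * f (c, 3))
  rw [sgn_three, (hs' c).2.1, sgn_one]
  split_ifs <;> simp

/-! ### The reduced Alexander module -/

/-- The generator of the reduced Alexander module given by an arc. -/
noncomputable def arcClass (α : D.Arc) : D.AlexanderModuleRed :=
  (LinearMap.range D.rhoRed).mkQ (Finsupp.single α 1)

@[simp] theorem crowellRed_arcClass (α : D.Arc) : D.crowellRed (D.arcClass α) = 1 := by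
  simp [crowellRed, arcClass]

theorem arcClass_sub_mem (α α' : D.Arc) :
    D.arcClass α - D.arcClass α' ∈ D.alexanderInvariantRed := by
  rw [alexanderInvariantRed, LinearMap.mem_ker, map_sub]
  simp

theorem arcClass_b₂ (c : D.Crossing) :
    D.arcClass (D.b₂ c) = (1 - tt) • D.arcClass (D.a c) + tt • D.arcClass (D.b₁ c) := by
  have : (LinearMap.range D.rhoRed).mkQ (D.rhoRed (Finsupp.single c 1)) = 0 :=
    (Submodule.Quotient.mk_eq_zero _).mpr ⟨_, rfl⟩
  rw [rhoRed, Finsupp.linearCombination_single, one_smul, map_sub, map_add, map_smul, map_smul,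
    sub_eq_zero] at this
  exact this.symm

theorem arcClass_induction {P : D.AlexanderModuleRed → Prop} (h₀ : P 0)
    (hadd : ∀ x y, P x → P y → P (x + y)) (hsmul : ∀ (p : Lam) x, P x → P (p • x))
    (harc : ∀ α, P (D.arcClass α)) (x : D.AlexanderModuleRed) : P x := by
  obtain ⟨v, rfl⟩ := Submodule.mkQ_surjective _ x
  induction v using Finsupp.induction_linear with
  | zero => simpa using h₀
  | add v w hv hw =>
    rw [map_add]
    exact hadd _ _ hv hw
  | single α p =>
    have : (Finsupp.single α p : D.Arc →₀ Lam) = p • Finsupp.single α 1 := by simp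
    rw [this, map_smul]
    exact hsmul _ _ (harc α)

/-- The elements annihilated by `1 - t` are multiples of the longitude of either component. -/
theorem exists_zsmul_longitude (hD : D.IsClassical) {i j : D.Component} (hij : i ≠ j)
    (hcover : ∀ k, k = i ∨ k = j) (x : D.AlexanderModuleRed) (hx : (1 - tt) • x = 0) :
    ∃ k : ℤ, x = k • ∑ c, D.underCycle i c • (D.arcClass (D.a c) - D.arcClass (D.b₁ c)) := by
  classical
  obtain ⟨v, rfl⟩ := Submodule.mkQ_surjective _ x
  rw [← map_smul, Submodule.mkQ_apply, Submodule.Quotient.mk_eq_zero] at hx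
  obtain ⟨w, hw⟩ := hx
  obtain ⟨r, hr, hr'⟩ := D.exists_rhoRed_eq_zero hD
  let A : (D.Arc →₀ Lam) →+ (D.Arc →₀ ℤ) := Finsupp.mapRange.addMonoidHom aug.toAddMonoidHom
  have hA : ∀ (p : Lam) v, A (p • v) = aug p • A v := fun p v => by
    ext α
    simp [A]
  have hA' : ∀ α, A (Finsupp.single α 1) = Finsupp.single α 1 := fun α => by simp [A]
  -- At `t = 1` the element `(1 - t) v` vanishes and the relation of `c` becomes `b₁ c - b₂ c`, so
  -- `aug ∘ w` is a cycle.
  obtain ⟨g, hg⟩ := D.exists_eq_of_sum_eq_zero (fun c => aug (w c)) (by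
    have := congrArg A hw
    rw [rhoRed_apply] at this
    simpa only [map_sum, hA, map_sub, map_add, hA', map_one, aug_T, sub_self, zero_smul, one_smul,
      zero_add] using this)
  -- Subtracting `g j • r` cancels the cycle on the component `j` and changes its multiplicity on
  -- `i` to `g i - g j`.
  have hdvd : ∀ c, (1 - tt) ∣ w c - g j • r c - ((g i - g j) * D.underCycle i c : ℤ) • 1 := by
    intro c
    apply one_sub_tt_dvd_of_aug_eq_zero
    simp only [map_sub, map_zsmul, map_one, hg, hr', underCycle]
    rcases hcover (D.underComponent c) with h | h
    · simp [h]
      ring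
    · simp [h, hij.symm]
      ring
  choose w' hw' using hdvd
  have hv : (1 - tt : Lam) • v = (1 - tt : Lam) • ((g i - g j) • (∑ c, D.underCycle i c •
      (Finsupp.single (D.a c) (1 : Lam) - Finsupp.single (D.b₁ c) 1)) +
      D.rhoRed (Finsupp.equivFunOnFinite.symm w')) := by
    -- The relation of `c` is `(1 - t)(a - b₁) + (b₁ - b₂)`. The second parts sum to zero over the
    -- cycle, so a factor `1 - t` splits off; it can be cancelled because `Λ^A(D)` is torsion-free.
    have h₁ := D.sum_underCycle i fun α => (Finsupp.single α 1 : D.Arc →₀ Lam)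
    rw [← hw, ← sub_zero (D.rhoRed w), ← smul_zero (g j), ← hr, ← add_zero (_ - _),
      ← smul_zero (g i - g j), ← h₁]
    simp only [rhoRed_apply, Finset.smul_sum, smul_add, ← Finset.sum_sub_distrib,
      ← Finset.sum_add_distrib, Finsupp.equivFunOnFinite_symm_apply_apply]
    refine Finset.sum_congr rfl fun c _ => ?_
    have : w c = (1 - tt) * w' c + g j • r c + ((g i - g j) * D.underCycle i c : ℤ) • 1 := by
      rw [← hw' c]
      ring
    rw [this]
    generalize g i - g j = k, D.underCycle i c = e
    module
  have hv' := smul_right_injective _ one_sub_tt_ne_zero hv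
  refine ⟨g i - g j, ?_⟩
  rw [hv', map_add, map_zsmul, map_sum]
  have h₀ : (LinearMap.range D.rhoRed).mkQ (D.rhoRed (Finsupp.equivFunOnFinite.symm w')) = 0 :=
    (Submodule.Quotient.mk_eq_zero _).mpr ⟨_, rfl⟩
  simp only [map_zsmul, map_sub, h₀, add_zero, arcClass]

end LinkDiagram

/-! ### Medial quandles given by presentations -/

/-- The value of a quandle expression in a `Λ`-module with the operation
`x ▷ y = t x + (1 - t) y`. -/
noncomputable def QuandleExpr.eval {A M : Type} [AddCommGroup M] [Module Lam M] (f : A → M) :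
    QuandleExpr A → M
  | .gen i => f i
  | .act y x => tt • x.eval f + (1 - tt) • y.eval f
  | .invAct y x => (T (-1) : Lam) • (x.eval f - (1 - tt) • y.eval f)

theorem MedialRel.eval_eq {A C M : Type} [AddCommGroup M] [Module Lam M] {b₁ a b₂ : C → A}
    {f : A → M} (hf : ∀ c, f (b₂ c) = (1 - tt) • f (a c) + tt • f (b₁ c)) {x y : QuandleExpr A}
    (h : MedialRel b₁ a b₂ x y) : x.eval f = y.eval f := by
  have hT : ∀ m : M, (T (-1) : Lam) • tt • m = m := fun m => by
    rw [smul_smul, ← T_add, neg_add_cancel, T_zero, one_smul]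
  have hT' : ∀ m : M, tt • (T (-1) : Lam) • m = m := fun m => by
    rw [smul_smul, ← T_add, add_neg_cancel, T_zero, one_smul]
  induction h with
  | refl => rfl
  | symm _ h => exact h.symm
  | trans _ _ h h' => exact h.trans h'
  | congr_act _ _ h h' => simp only [QuandleExpr.eval, h, h']
  | congr_invAct _ _ h h' => simp only [QuandleExpr.eval, h, h']
  | self_distrib => simp only [QuandleExpr.eval]; module
  | left_inv => simp only [QuandleExpr.eval, add_sub_cancel_right, hT]
  | right_inv => simp only [QuandleExpr.eval, hT', sub_add_cancel]
  | fix => simp only [QuandleExpr.eval]; module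
  | medial => simp only [QuandleExpr.eval]; module
  | rel c => simp only [QuandleExpr.eval, hf, add_comm]

namespace PresentedMedialQuandle

variable {A C : Type} {b₁ a b₂ : C → A}

variable (b₁ a b₂) in
/-- The generators of a presented medial quandle. -/
def of (i : A) : PresentedMedialQuandle b₁ a b₂ := Quotient.mk _ (.gen i)

@[elab_as_elim]
theorem induction {P : PresentedMedialQuandle b₁ a b₂ → Prop} (hof : ∀ i, P (of b₁ a b₂ i))
    (hact : ∀ y x, P y → P x → P (y ◃ x)) (hinv : ∀ y x, P y → P x → P (y ◃⁻¹ x)) (x) : P x := by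
  obtain ⟨x⟩ := x
  induction x with
  | gen i => exact hof i
  | act y x hy hx => exact hact _ _ hy hx
  | invAct y x hy hx => exact hinv _ _ hy hx

theorem isAbelian : Rack.IsAbelian (PresentedMedialQuandle b₁ a b₂) := by
  rintro ⟨x⟩ ⟨y⟩ ⟨z⟩ ⟨w⟩
  exact Quotient.sound (.medial x y z w)

theorem act_of (c : C) : of b₁ a b₂ (a c) ◃ of b₁ a b₂ (b₁ c) = of b₁ a b₂ (b₂ c) :=
  Quotient.sound (.rel c)

end PresentedMedialQuandle

/-- Displacements of a medial quandle as a function of the elements of the quandle. -/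
theorem Quandle.exists_displacement {Q : Type} [Quandle Q] (hQ : Rack.IsAbelian Q) (x₀ : Q) :
    ∃ (E : Type) (_ : AddCommGroup E) (_ : Module Lam E) (ι : Multiplicative E →* Equiv.Perm Q)
      (e : Q → E), (∀ y, ι (.ofAdd (e y)) = Rack.act' y * (Rack.act' x₀)⁻¹) ∧
      (∀ v : E, ι (.ofAdd (tt • v)) = Rack.act' x₀ * ι (.ofAdd v) * (Rack.act' x₀)⁻¹) ∧
      (∀ x y, e (y ◃ x) = (1 - tt) • e y + tt • e x) := by
  obtain ⟨E, _, _, ι, he, hι, ht⟩ := Quandle.exists_module_displacement hQ x₀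
  choose e he using he
  refine ⟨E, _, _, ι, e, he, ht, fun x y => ?_⟩
  apply Multiplicative.ofAdd.injective
  apply hι
  rw [sub_smul, one_smul, sub_add_eq_add_sub, sub_eq_add_neg]
  simp only [ofAdd_add, ofAdd_neg, map_mul, map_inv, he, ht, Rack.ad_conj]
  group

/-! ### The action of the Alexander module on the medial quandle -/

namespace LinkDiagram

variable (D : LinkDiagram)

/-- The generator of the medial quandle given by an arc. -/
def arcElement (α : D.Arc) : D.MQ := PresentedMedialQuandle.of _ _ _ α

/-- The map from the medial quandle to the reduced Alexander module, `q_a ↦ a`. -/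
noncomputable def toModule : D.MQ → D.AlexanderModuleRed :=
  Quotient.lift (QuandleExpr.eval D.arcClass) fun _ _ h => MedialRel.eval_eq D.arcClass_b₂ h

@[simp] theorem toModule_arcElement (α : D.Arc) : D.toModule (D.arcElement α) = D.arcClass α := rfl

theorem toModule_act (y x : D.MQ) :
    D.toModule (y ◃ x) = tt • D.toModule x + (1 - tt) • D.toModule y := by
  obtain ⟨x⟩ := x
  obtain ⟨y⟩ := y
  rfl

theorem toModule_invAct (y x : D.MQ) :
    D.toModule (y ◃⁻¹ x) = (T (-1) : Lam) • (D.toModule x - (1 - tt) • D.toModule y) := by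
  obtain ⟨x⟩ := x
  obtain ⟨y⟩ := y
  rfl

theorem crowellRed_toModule (x : D.MQ) : D.crowellRed (D.toModule x) = 1 := by
  induction x using PresentedMedialQuandle.induction with
  | hof α => exact D.crowellRed_arcClass α
  | hact y x hy hx => simp [toModule_act, -map_sub, hy, hx]
  | hinv y x hy hx =>
    simp only [toModule_invAct, map_smul, map_sub, hy, hx, smul_eq_mul, mul_one, sub_sub_cancel]
    rw [← T_add]
    simp

theorem toModule_sub_mem (x y : D.MQ) : D.toModule x - D.toModule y ∈ D.alexanderInvariantRed := by
  rw [alexanderInvariantRed, LinearMap.mem_ker, map_sub, crowellRed_toModule, crowellRed_toModule,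
    sub_self]

/-- A homomorphism from the reduced Alexander module to the permutations of the medial quandle that
maps the class of `y` to the displacement `x ↦ (x ▷⁻¹ x₀) ▷ y`. -/
structure IsDisplacementHom (x₀ : D.MQ)
    (θ : Multiplicative D.AlexanderModuleRed →* Equiv.Perm D.MQ) : Prop where
  map_toModule : ∀ y, θ (.ofAdd (D.toModule y)) = Rack.act' y * (Rack.act' x₀)⁻¹
  map_smul : ∀ m, θ (.ofAdd (tt • m)) = Rack.act' x₀ * θ (.ofAdd m) * (Rack.act' x₀)⁻¹

theorem exists_other_component (hμ : D.numComponents = 2) (i : D.Component) :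
    ∃ j, i ≠ j ∧ ∀ k, k = i ∨ k = j := by
  obtain ⟨x, y, hxy, h⟩ := Nat.card_eq_two_iff.mp hμ
  have h' : ∀ k, k = x ∨ k = y := fun k => by
    simpa using h.ge (Set.mem_univ k)
  rcases h' i with rfl | rfl
  · exact ⟨y, hxy, h'⟩
  · exact ⟨x, hxy.symm, fun k => (h' k).symm⟩

/-- The reduced Alexander module acts on the medial quandle by displacements. -/
theorem exists_displacementHom (x₀ : D.MQ) :
    ∃ θ : Multiplicative D.AlexanderModuleRed →* Equiv.Perm D.MQ, D.IsDisplacementHom x₀ θ := by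
  obtain ⟨E, _, _, ι, e, he, ht, hact⟩ :=
    Quandle.exists_displacement PresentedMedialQuandle.isAbelian x₀
  let Θ : D.AlexanderModuleRed →ₗ[Lam] E :=
    (LinearMap.range D.rhoRed).liftQ
      (Finsupp.linearCombination Lam fun α => e (D.arcElement α)) (by
        rw [LinearMap.range_le_ker_iff]
        ext c
        have := hact (D.arcElement (D.b₁ c)) (D.arcElement (D.a c))
        simp only [arcElement, PresentedMedialQuandle.act_of] at this
        simp [rhoRed, arcElement, this, sub_smul])
  have hΘ : ∀ y, Θ (D.toModule y) = e y := by
    intro y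
    induction y using PresentedMedialQuandle.induction with
    | hof α =>
      change Θ (D.arcClass α) = _
      simp [Θ, arcClass, arcElement]
    | hact y x hy hx => rw [toModule_act, map_add, map_smul, map_smul, hact, hy, hx, add_comm]
    | hinv y x hy hx =>
      have h := hact (y ◃⁻¹ x) y
      rw [Rack.right_inv] at h
      rw [toModule_invAct, map_smul, map_sub, map_smul, hy, hx, h, add_sub_cancel_left, smul_smul,
        ← T_add, neg_add_cancel, T_zero, one_smul]
  refine ⟨ι.comp (AddMonoidHom.toMultiplicative Θ.toAddMonoidHom), fun y => ?_, fun m => ?_⟩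
  · exact (congrArg (fun v => ι (.ofAdd v)) (hΘ y)).trans (he y)
  · exact (congrArg (fun v => ι (.ofAdd v)) (Θ.map_smul tt m)).trans (ht _)

theorem exists_two_arcs (hμ : D.numComponents = 2) :
    ∃ α₁ α₂ : D.Arc, D.componentOf α₁ ≠ D.componentOf α₂ ∧
      ∀ α, D.componentOf α = D.componentOf α₁ ∨ D.componentOf α = D.componentOf α₂ := by
  obtain ⟨i, -⟩ := Nat.card_eq_two_iff.mp hμ
  obtain ⟨j, hij, hcover⟩ := D.exists_other_component hμ i
  obtain ⟨α₁, rfl⟩ := D.componentOf_surjective i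
  obtain ⟨α₂, rfl⟩ := D.componentOf_surjective j
  exact ⟨α₁, α₂, hij, fun _ => hcover _⟩

namespace IsDisplacementHom

variable {D} {x₀ : D.MQ} {θ : Multiplicative D.AlexanderModuleRed →* Equiv.Perm D.MQ}

/-- In the difference of the two classes the base point `x₀` cancels, and `x` is fixed by its own
translation. -/
theorem act_eq (hθ : D.IsDisplacementHom x₀ θ) (y x : D.MQ) :
    y ◃ x = θ (.ofAdd (D.toModule y - D.toModule x)) x := by
  rw [sub_eq_add_neg, ofAdd_add, ofAdd_neg, map_mul, map_inv, hθ.map_toModule, hθ.map_toModule]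
  simp

theorem invAct_eq (hθ : D.IsDisplacementHom x₀ θ) (y x : D.MQ) :
    y ◃⁻¹ x = θ (.ofAdd (D.toModule (y ◃⁻¹ x) - D.toModule y)) x := by
  have h := hθ.act_eq y (y ◃⁻¹ x)
  rw [Rack.right_inv] at h
  rw [← neg_sub, ofAdd_neg, map_inv]
  exact Equiv.Perm.eq_inv_iff_eq.mpr h.symm

/-- The `m` that satisfy this form a subgroup. It is stable under `t` and `t⁻¹`, which act as
conjugation by the translation of `x₀`, and it contains the arcs. The correction by `x₀` reflects
that the class of `x₀` acts trivially. -/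
theorem toModule_apply (hθ : D.IsDisplacementHom x₀ θ) (m : D.AlexanderModuleRed) (x : D.MQ) :
    D.toModule (θ (.ofAdd m) x) =
      D.toModule x + (1 - tt) • (m - D.crowellRed m • D.toModule x₀) := by
  let H : AddSubgroup D.AlexanderModuleRed :=
    { carrier := {m | ∀ x, D.toModule (θ (.ofAdd m) x) =
        D.toModule x + (1 - tt) • (m - D.crowellRed m • D.toModule x₀)}
      add_mem' := fun {m n} hm hn x => by
        rw [ofAdd_add, map_mul, Equiv.Perm.mul_apply, hm, hn, map_add]
        module
      zero_mem' := fun x => by simp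
      neg_mem' := fun {m} hm x => by
        have h := hm (θ (.ofAdd (-m)) x)
        rw [← Equiv.Perm.mul_apply, ← map_mul, ← ofAdd_add, add_neg_cancel, ofAdd_zero, map_one,
          Equiv.Perm.one_apply] at h
        rw [h, D.crowellRed.map_neg]
        module }
  have hconj : ∀ m x, D.toModule (θ (.ofAdd (tt • m)) (x₀ ◃ x)) =
      tt • D.toModule (θ (.ofAdd m) x) + (1 - tt) • D.toModule x₀ := fun m x => by
    rw [hθ.map_smul, ← toModule_act]
    simp [← Rack.act'_apply]
  have h₁ : ∀ m ∈ H, tt • m ∈ H := fun m hm x => by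
    have h := hconj m (x₀ ◃⁻¹ x)
    have h' := D.toModule_act x₀ (x₀ ◃⁻¹ x)
    rw [Rack.right_inv] at h h'
    rw [h, hm, h', LinearMap.map_smul]
    module
  have h₂ : ∀ m ∈ H, (T (-1) : Lam) • m ∈ H := fun m hm x => by
    have hT : ∀ z : D.AlexanderModuleRed, (T (-1) : Lam) • tt • z = z := fun z => by
      rw [smul_smul, ← T_add, neg_add_cancel, T_zero, one_smul]
    obtain ⟨n, rfl⟩ : ∃ n, m = tt • n := ⟨(T (-1) : Lam) • m, by
      rw [smul_smul, ← T_add, add_neg_cancel, T_zero, one_smul]⟩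
    have h := hconj n x
    rw [hm, toModule_act, LinearMap.map_smul, smul_eq_mul] at h
    rw [hT, ← hT (D.toModule (θ _ x)), eq_sub_of_add_eq h.symm, ← hT (D.toModule x + _)]
    congr 1
    module
  suffices AddSubgroup.toLamSubmodule H h₁ h₂ = ⊤ from
    (this.ge (Submodule.mem_top : m ∈ ⊤) : m ∈ H) x
  refine eq_top_iff.mpr fun m _ => ?_
  induction m using D.arcClass_induction with
  | h₀ => exact Submodule.zero_mem _
  | hadd x y hx hy => exact Submodule.add_mem _ (hx trivial) (hy trivial)
  | hsmul p x hx => exact Submodule.smul_mem _ _ (hx trivial)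
  | harc α =>
    intro x
    have h := D.toModule_act x₀ (x₀ ◃⁻¹ x)
    rw [Rack.right_inv] at h
    have h' := D.toModule_act (D.arcElement α) (x₀ ◃⁻¹ x)
    rw [← D.toModule_arcElement, hθ.map_toModule, Equiv.Perm.mul_apply, Rack.invAct_apply,
      Rack.act'_apply, h, h', crowellRed_toModule]
    module

theorem toModule_apply_of_mem (hθ : D.IsDisplacementHom x₀ θ) {m : D.AlexanderModuleRed}
    (hm : m ∈ D.alexanderInvariantRed) (x : D.MQ) :
    D.toModule (θ (.ofAdd m) x) = D.toModule x + (1 - tt) • m := by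
  rw [hθ.toModule_apply, LinearMap.mem_ker.mp hm, zero_smul, sub_zero]

theorem exists_eq (hθ : D.IsDisplacementHom x₀ θ) (x : D.MQ) :
    ∃ α, ∃ m ∈ D.alexanderInvariantRed, x = θ (.ofAdd m) (D.arcElement α) := by
  induction x using PresentedMedialQuandle.induction with
  | hof α => exact ⟨α, 0, Submodule.zero_mem _, by simp [arcElement]⟩
  | hact y x _ hx =>
    obtain ⟨α, m, hm, h⟩ := hx
    refine ⟨α, _, Submodule.add_mem _ (D.toModule_sub_mem y x) hm, ?_⟩
    rw [ofAdd_add, map_mul, Equiv.Perm.mul_apply, ← h, ← hθ.act_eq]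
  | hinv y x _ hx =>
    obtain ⟨α, m, hm, h⟩ := hx
    refine ⟨α, _, Submodule.add_mem _ (D.toModule_sub_mem (y ◃⁻¹ x) y) hm, ?_⟩
    rw [ofAdd_add, map_mul, Equiv.Perm.mul_apply, ← h, ← hθ.invAct_eq]

theorem arcElement_b₂ (hθ : D.IsDisplacementHom x₀ θ) (c : D.Crossing) :
    D.arcElement (D.b₂ c) =
      θ (.ofAdd (D.arcClass (D.a c) - D.arcClass (D.b₁ c))) (D.arcElement (D.b₁ c)) := by
  rw [← D.toModule_arcElement, ← D.toModule_arcElement, ← hθ.act_eq]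
  exact (PresentedMedialQuandle.act_of c).symm

theorem exists_arcElement_eq (hθ : D.IsDisplacementHom x₀ θ) {α α' : D.Arc}
    (h : D.componentOf α = D.componentOf α') :
    ∃ m ∈ D.alexanderInvariantRed, D.arcElement α' = θ (.ofAdd m) (D.arcElement α) := by
  let s : Setoid D.Arc :=
    { r := fun α α' =>
        ∃ m ∈ D.alexanderInvariantRed, D.arcElement α' = θ (.ofAdd m) (D.arcElement α)
      iseqv := by
        refine ⟨fun α => ⟨0, Submodule.zero_mem _, by simp⟩, ?_, ?_⟩
        · rintro α α' ⟨m, hm, h⟩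
          refine ⟨-m, Submodule.neg_mem _ hm, ?_⟩
          rw [h, ← Equiv.Perm.mul_apply, ← map_mul, ← ofAdd_add, neg_add_cancel]
          simp
        · rintro α α' α'' ⟨m, hm, h⟩ ⟨n, hn, h'⟩
          refine ⟨n + m, Submodule.add_mem _ hn hm, ?_⟩
          rw [h', h, ← Equiv.Perm.mul_apply, ← map_mul, ← ofAdd_add] }
  exact D.rel_of_componentOf_eq s (fun c => ⟨_, D.arcClass_sub_mem _ _, hθ.arcElement_b₂ c⟩) h

/-- The longitude of a component fixes the elements of the medial quandle given by its arcs. -/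
theorem longitude_apply (hθ : D.IsDisplacementHom x₀ θ) (α : D.Arc) :
    θ (.ofAdd (∑ c, D.underCycle (D.componentOf α) c •
      (D.arcClass (D.a c) - D.arcClass (D.b₁ c)))) (D.arcElement α) = D.arcElement α := by
  classical
  let St : AddSubgroup D.AlexanderModuleRed :=
    { carrier := {m | θ (.ofAdd m) (D.arcElement α) = D.arcElement α}
      add_mem' := fun {m n} hm hn => by
        rw [Set.mem_ofPred_eq] at hm hn ⊢
        rw [ofAdd_add, map_mul, Equiv.Perm.mul_apply, hn, hm]
      zero_mem' := by simp
      neg_mem' := fun {m} hm => by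
        rw [Set.mem_ofPred_eq] at hm ⊢
        rw [ofAdd_neg, map_inv, Equiv.Perm.inv_eq_iff_eq, hm] }
  -- `p α'` carries `q_α` to `q_α'` on the component of `α`; elsewhere its value is immaterial
  -- because `underCycle` vanishes.
  have hp : ∀ α', ∃ m, D.componentOf α = D.componentOf α' →
      D.arcElement α' = θ (.ofAdd m) (D.arcElement α) := fun α' => by
    by_cases h : D.componentOf α = D.componentOf α'
    · obtain ⟨m, -, hm⟩ := hθ.exists_arcElement_eq h
      exact ⟨m, fun _ => hm⟩
    · exact ⟨0, fun h' => absurd h' h⟩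
  choose p hp using hp
  change _ ∈ St
  -- After subtraction of the telescoping sum of `p`, each summand separately fixes `q_α`: it goes
  -- to `b₁ c`, passes under `a c` to `b₂ c`, and returns.
  rw [← sub_zero (∑ c, _), ← D.sum_underCycle (D.componentOf α) p, ← Finset.sum_sub_distrib]
  refine St.sum_mem fun c _ => ?_
  rw [← smul_sub]
  by_cases h : D.underComponent c = D.componentOf α
  · refine St.zsmul_mem ?_ _
    have h₁ := hp (D.b₁ c) h.symm
    have h₂ := hp (D.b₂ c) ((D.componentOf_b₂ c).trans h).symm
    have h₃ := hθ.arcElement_b₂ c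
    change θ _ _ = _
    rw [h₁, h₂, ← Equiv.Perm.mul_apply, ← map_mul, ← ofAdd_add] at h₃
    rw [show ∀ v p₁ p₂ : D.AlexanderModuleRed, v - (p₂ - p₁) = -p₂ + (v + p₁) by intros; abel,
      ofAdd_add, map_mul, Equiv.Perm.mul_apply, ← h₃, ofAdd_neg, map_inv,
      Equiv.Perm.inv_eq_iff_eq]
  · rw [underCycle, if_neg h, zero_smul]
    exact St.zero_mem

/-- As `m` is a multiple of either longitude, the one that belongs to the component of `α` itself
can be chosen. -/
theorem apply_arcElement (hθ : D.IsDisplacementHom x₀ θ) (hD : D.IsClassical)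
    (hμ : D.numComponents = 2) {m : D.AlexanderModuleRed} (hm : (1 - tt) • m = 0) (α : D.Arc) :
    θ (.ofAdd m) (D.arcElement α) = D.arcElement α := by
  obtain ⟨j, hj, hcover⟩ := D.exists_other_component hμ (D.componentOf α)
  obtain ⟨k, rfl⟩ := D.exists_zsmul_longitude hD hj hcover m hm
  rw [ofAdd_zsmul, map_zpow]
  exact Equiv.Perm.zpow_apply_eq_self_of_apply_eq_self (hθ.longitude_apply α) k

end IsDisplacementHom

end LinkDiagram

/-! ### The image and injectivity of the map to the Alexander module, and `N / (1 - t) N` -/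

namespace LinkDiagram

variable (D : LinkDiagram)

theorem mem_range_toModule (x : D.AlexanderModuleRed) :
    x ∈ Set.range D.toModule ↔
      ∃ α, ∃ m ∈ D.alexanderInvariantRed, x = D.arcClass α + (1 - tt) • m := by
  constructor
  · rintro ⟨y, rfl⟩
    obtain ⟨θ, hθ⟩ := D.exists_displacementHom y
    obtain ⟨α, m, hm, h⟩ := hθ.exists_eq y
    refine ⟨α, m, hm, ?_⟩
    conv_lhs => rw [h]
    rw [hθ.toModule_apply_of_mem hm, toModule_arcElement]
  · rintro ⟨α, m, hm, rfl⟩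
    obtain ⟨θ, hθ⟩ := D.exists_displacementHom (D.arcElement α)
    exact ⟨θ (.ofAdd m) (D.arcElement α), hθ.toModule_apply_of_mem hm _⟩

/-! ### The module `N / (1 - t) N` -/

/-- At an underpass, `b₁ - b₂ = (1 - t)(b₁ - a)`, and underpasses join all arcs of a component. -/
theorem exists_arcClass_sub_eq {α α' : D.Arc} (h : D.componentOf α = D.componentOf α') :
    ∃ m ∈ D.alexanderInvariantRed, D.arcClass α - D.arcClass α' = (1 - tt) • m := by
  let s : Setoid D.Arc :=
    { r := fun α α' =>
        ∃ m ∈ D.alexanderInvariantRed, D.arcClass α - D.arcClass α' = (1 - tt) • m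
      iseqv := by
        refine ⟨fun α => ⟨0, Submodule.zero_mem _, by simp⟩, ?_, ?_⟩
        · rintro α α' ⟨m, hm, h⟩
          exact ⟨-m, Submodule.neg_mem _ hm, by rw [smul_neg, ← h, neg_sub]⟩
        · rintro α α' α'' ⟨m, hm, h⟩ ⟨n, hn, h'⟩
          exact ⟨m + n, Submodule.add_mem _ hm hn, by rw [smul_add, ← h, ← h', sub_add_sub_cancel]⟩ }
  exact D.rel_of_componentOf_eq s
    (fun c => ⟨_, D.arcClass_sub_mem (D.b₁ c) (D.a c), by rw [arcClass_b₂]; module⟩) h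

open Classical in
/-- The sum of the coefficients at the arcs of a given component, at `t = 1`. -/
noncomputable def componentDegree (i : D.Component) : D.AlexanderModuleRed →ₛₗ[aug] ℤ :=
  (LinearMap.range D.rhoRed).liftQ (aug.toSemilinearMap.comp
    (Finsupp.linearCombination Lam fun α => if D.componentOf α = i then (1 : Lam) else 0)) (by
      rintro _ ⟨w, rfl⟩
      rw [LinearMap.mem_ker, LinearMap.comp_apply, rhoRed_apply, map_sum, map_sum]
      refine Finset.sum_eq_zero fun c _ => ?_
      have : D.componentOf (D.b₁ c) = D.underComponent c := rfl
      simp only [map_smul, map_sub, map_add, Finsupp.linearCombination_single,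
        smul_eq_mul, RingHom.coe_toSemilinearMap, map_mul, aug_T, map_one, componentOf_b₂, this]
      ring)

open Classical in
theorem componentDegree_arcClass (i : D.Component) (α : D.Arc) :
    D.componentDegree i (D.arcClass α) = if D.componentOf α = i then 1 else 0 := by
  simp only [componentDegree, arcClass, Submodule.mkQ_apply, Submodule.liftQ_apply,
    LinearMap.comp_apply, Finsupp.linearCombination_single, one_smul, RingHom.coe_toSemilinearMap]
  split_ifs <;> simp

theorem componentOf_eq_of_arcClass_sub_eq {α α' : D.Arc} {m : D.AlexanderModuleRed}
    (h : D.arcClass α - D.arcClass α' = (1 - tt) • m) : D.componentOf α = D.componentOf α' := by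
  have := congrArg (D.componentDegree (D.componentOf α')) h
  rw [map_sub, map_smulₛₗ, componentDegree_arcClass, componentDegree_arcClass] at this
  by_contra hne
  simp [hne] at this

/-- Equal images force the arcs `α`, `α'` onto one component, so both elements can be written as
displacements of `q_α`. These displacements differ by an element annihilated by `1 - t`, which fixes
`q_α`. -/
theorem toModule_injective (hD : D.IsClassical) (hμ : D.numComponents = 2) :
    Function.Injective D.toModule := by
  intro x y hxy
  obtain ⟨θ, hθ⟩ := D.exists_displacementHom x
  obtain ⟨α, m, hm, hx⟩ := hθ.exists_eq x
  obtain ⟨α', n, hn, hy⟩ := hθ.exists_eq y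
  have h₁ := hxy
  rw [hx, hy, hθ.toModule_apply_of_mem hm, hθ.toModule_apply_of_mem hn, toModule_arcElement,
    toModule_arcElement] at h₁
  obtain ⟨k, hk, hα⟩ := hθ.exists_arcElement_eq (D.componentOf_eq_of_arcClass_sub_eq (m := n - m) (by
    rw [smul_sub, sub_eq_sub_iff_add_eq_add, h₁, add_comm]))
  rw [hα, ← Equiv.Perm.mul_apply, ← map_mul, ← ofAdd_add] at hy
  have h₂ := hxy
  rw [hx, hy, hθ.toModule_apply_of_mem hm,
    hθ.toModule_apply_of_mem (Submodule.add_mem _ hn hk), add_right_inj, eq_comm, ← sub_eq_zero,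
    ← smul_sub] at h₂
  have h₃ := hθ.apply_arcElement hD hμ h₂ α
  rw [sub_eq_neg_add, ofAdd_add, map_mul, Equiv.Perm.mul_apply, ← hy, ofAdd_neg, map_inv,
    Equiv.Perm.inv_eq_iff_eq, ← hx] at h₃
  exact h₃.symm

theorem exists_eq_smul_add {α₁ α₂ : D.Arc}
    (hcover : ∀ α, D.componentOf α = D.componentOf α₁ ∨ D.componentOf α = D.componentOf α₂)
    (x : D.AlexanderModuleRed) : ∃ m ∈ D.alexanderInvariantRed, ∃ p q : Lam,
      x = (1 - tt) • m + p • D.arcClass α₁ + q • D.arcClass α₂ := by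
  induction x using D.arcClass_induction with
  | h₀ => exact ⟨0, Submodule.zero_mem _, 0, 0, by simp⟩
  | hadd x y hx hy =>
    obtain ⟨m, hm, p, q, rfl⟩ := hx
    obtain ⟨m', hm', p', q', rfl⟩ := hy
    exact ⟨m + m', Submodule.add_mem _ hm hm', p + p', q + q', by module⟩
  | hsmul r x hx =>
    obtain ⟨m, hm, p, q, rfl⟩ := hx
    exact ⟨r • m, Submodule.smul_mem _ _ hm, r * p, r * q, by module⟩
  | harc α =>
    rcases hcover α with h | h
    · obtain ⟨m, hm, h'⟩ := D.exists_arcClass_sub_eq h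
      exact ⟨m, hm, 1, 0, by rw [← h']; module⟩
    · obtain ⟨m, hm, h'⟩ := D.exists_arcClass_sub_eq h
      exact ⟨m, hm, 0, 1, by rw [← h']; module⟩

/-- Modulo `(1 - t) N`, `x` is `p α₁ + q α₂`. The Crowell map gives `q = -p`, and degree zero makes
`p` divisible by `1 - t`. -/
theorem exists_eq_one_sub_smul {α₁ α₂ : D.Arc} (hne : D.componentOf α₁ ≠ D.componentOf α₂)
    (hcover : ∀ α, D.componentOf α = D.componentOf α₁ ∨ D.componentOf α = D.componentOf α₂)
    {x : D.AlexanderModuleRed} (hx : x ∈ D.alexanderInvariantRed)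
    (hx' : D.componentDegree (D.componentOf α₁) x = 0) :
    ∃ m ∈ D.alexanderInvariantRed, x = (1 - tt) • m := by
  obtain ⟨m, hm, p, q, rfl⟩ := D.exists_eq_smul_add hcover x
  rw [alexanderInvariantRed, LinearMap.mem_ker] at hx hm
  simp only [map_add, map_smul, hm, mul_zero, zero_add, crowellRed_arcClass, smul_eq_mul,
    mul_one] at hx
  obtain rfl : q = -p := eq_neg_of_add_eq_zero_right hx
  simp only [map_add, map_smulₛₗ, componentDegree_arcClass, hne.symm, if_true, if_false, map_sub,
    map_one, aug_T, sub_self, zero_mul, mul_zero, add_zero, zero_add, smul_eq_mul, mul_one] at hx'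
  obtain ⟨p', rfl⟩ := one_sub_tt_dvd_of_aug_eq_zero hx'
  exact ⟨m + p' • (D.arcClass α₁ - D.arcClass α₂),
    Submodule.add_mem _ hm (Submodule.smul_mem _ _ (D.arcClass_sub_mem _ _)), by module⟩

/-- The map `N → ℤ` with kernel `(1 - t) N`. -/
noncomputable def invariantDegree (i : D.Component) : D.alexanderInvariantRed →ₛₗ[aug] ℤ :=
  (D.componentDegree i).comp D.alexanderInvariantRed.subtype

theorem invariantDegree_apply (i : D.Component) (x : D.alexanderInvariantRed) :
    D.invariantDegree i x = D.componentDegree i x := rfl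

theorem ker_invariantDegree {α₁ α₂ : D.Arc} (hne : D.componentOf α₁ ≠ D.componentOf α₂)
    (hcover : ∀ α, D.componentOf α = D.componentOf α₁ ∨ D.componentOf α = D.componentOf α₂) :
    LinearMap.ker (D.invariantDegree (D.componentOf α₁)) = oneSubTMul D.alexanderInvariantRed := by
  ext x
  constructor
  · intro hx
    obtain ⟨m, hm, h⟩ := D.exists_eq_one_sub_smul hne hcover x.2 hx
    exact ⟨⟨m, hm⟩, Subtype.ext h.symm⟩
  · rintro ⟨m, rfl⟩
    rw [LinearMap.mem_ker, LinearMap.lsmul_apply, map_smulₛₗ]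
    simp

theorem invariantDegree_sub {α₁ α₂ : D.Arc} (hne : D.componentOf α₁ ≠ D.componentOf α₂) :
    D.invariantDegree (D.componentOf α₁) ⟨_, D.arcClass_sub_mem α₁ α₂⟩ = 1 := by
  rw [invariantDegree_apply, map_sub, componentDegree_arcClass, componentDegree_arcClass]
  simp [hne.symm]

theorem nonempty_addEquiv_int {α₁ α₂ : D.Arc} (hne : D.componentOf α₁ ≠ D.componentOf α₂)
    (hcover : ∀ α, D.componentOf α = D.componentOf α₁ ∨ D.componentOf α = D.componentOf α₂) :
    Nonempty ((D.alexanderInvariantRed ⧸ oneSubTMul D.alexanderInvariantRed) ≃+ ℤ) := by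
  let f := (oneSubTMul D.alexanderInvariantRed).liftQ (D.invariantDegree (D.componentOf α₁))
    (D.ker_invariantDegree hne hcover).ge
  refine ⟨AddEquiv.ofBijective f ⟨?_, fun n => ?_⟩⟩
  · refine LinearMap.ker_eq_bot.mp (Submodule.ker_liftQ_eq_bot _ _ _ ?_)
    exact (D.ker_invariantDegree hne hcover).le
  · refine ⟨n • (oneSubTMul D.alexanderInvariantRed).mkQ ⟨_, D.arcClass_sub_mem α₁ α₂⟩, ?_⟩
    rw [map_zsmul]
    change n • D.invariantDegree (D.componentOf α₁) ⟨_, D.arcClass_sub_mem α₁ α₂⟩ = n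
    rw [D.invariantDegree_sub hne, smul_eq_mul, mul_one]

/-- A generator of `N / (1 - t) N` is represented by the difference of two arcs. -/
theorem exists_arcs_of_span_eq_top (hμ : D.numComponents = 2) (d : D.alexanderInvariantRed)
    (hd : Submodule.span Lam {(oneSubTMul D.alexanderInvariantRed).mkQ d} = ⊤) :
    ∃ α₁ α₂ : D.Arc, D.componentOf α₁ ≠ D.componentOf α₂ ∧
      (∀ α, D.componentOf α = D.componentOf α₁ ∨ D.componentOf α = D.componentOf α₂) ∧
      ∃ m ∈ D.alexanderInvariantRed, d - (D.arcClass α₁ - D.arcClass α₂) = (1 - tt) • m := by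
  obtain ⟨α₁, α₂, hne, hcover⟩ := D.exists_two_arcs hμ
  obtain ⟨p, hp⟩ := Submodule.mem_span_singleton.mp
    (hd.ge (Submodule.mem_top (x := (oneSubTMul D.alexanderInvariantRed).mkQ
      ⟨_, D.arcClass_sub_mem α₁ α₂⟩)))
  rw [← map_smul, ← sub_eq_zero, ← map_sub, Submodule.mkQ_apply, Submodule.Quotient.mk_eq_zero,
    ← D.ker_invariantDegree hne hcover, LinearMap.mem_ker, map_sub, map_smulₛₗ,
    D.invariantDegree_sub hne, sub_eq_zero, smul_eq_mul] at hp
  -- A generator has degree `1` or `-1`; the sign decides which arc comes first.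
  rcases Int.eq_one_or_neg_one_of_mul_eq_one' hp with ⟨-, h⟩ | ⟨-, h⟩
  · refine ⟨α₁, α₂, hne, hcover, D.exists_eq_one_sub_smul hne hcover
      (Submodule.sub_mem _ d.2 (D.arcClass_sub_mem _ _)) ?_⟩
    have := D.invariantDegree_sub hne
    rw [invariantDegree_apply] at this h
    rw [map_sub, this]
    simpa [sub_eq_zero] using h
  · refine ⟨α₂, α₁, hne.symm, fun α => (hcover α).symm, D.exists_eq_one_sub_smul hne hcover
      (Submodule.sub_mem _ d.2 (D.arcClass_sub_mem _ _)) ?_⟩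
    have := D.invariantDegree_sub hne
    rw [invariantDegree_apply] at this h
    rw [← neg_sub (D.arcClass α₁), sub_neg_eq_add, map_add, this]
    lia

end LinkDiagram

/-! ### The quandle `Q(N, (d, 0), (X, X))` -/

namespace MedialData

variable {M : Type*} [AddCommGroup M] [Module Lam M] {N : Submodule Lam M}

/-- The map from `Q(N, (d, 0), (X, X))` to `M` that maps `x + Xᵢ` to `e + mᵢ + (1 - t) x`. -/
noncomputable def pairToModule (d : N) (e : M) (q : (pair N d).Q) : M :=
  e + (pair N d).m q.1 + (Submodule.liftQ (Submodule.torsionBy Lam N (1 - tt))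
    (N.subtype.comp (LinearMap.lsmul Lam N (1 - tt))) (by
      intro x hx
      exact congrArg N.subtype hx)) q.2

theorem pairToModule_coset (d : N) (e : M) (i : Fin 2) (x : N) :
    pairToModule d e ((pair N d).coset i x) = e + (pair N d).m i + (1 - tt) • (x : M) := rfl

theorem pairToModule_act (d : N) (e : M) (y x : (pair N d).Q) :
    pairToModule d e (y ◃ x) = tt • pairToModule d e x + (1 - tt) • pairToModule d e y := by
  obtain ⟨i, x, rfl⟩ := (pair N d).exists_coset x
  obtain ⟨j, y, rfl⟩ := (pair N d).exists_coset y
  change pairToModule d e ((pair N d).op _ _) = _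
  simp only [op_coset, pairToModule_coset, diff, Submodule.coe_add, Submodule.coe_smul]
  module

theorem pairToModule_injective (d : N) (e : M) (hd : d ∉ oneSubTMul N) :
    Function.Injective (pairToModule d e) := by
  have key : ∀ (x y : N), (d : M) + (1 - tt) • (x : M) ≠ (1 - tt) • (y : M) := fun x y h =>
    hd ⟨y - x, Subtype.ext (by
      rw [LinearMap.lsmul_apply, Submodule.coe_smul, Submodule.coe_sub, smul_sub, ← h,
        add_sub_cancel_right])⟩
  have hX : ∀ (i : Fin 2) (x y : N), (1 - tt) • (x : M) = (1 - tt) • (y : M) →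
      (pair N d).coset i x = (pair N d).coset i y := fun i x y h => by
    refine congrArg (Sigma.mk i) ((Submodule.Quotient.eq _).mpr ?_)
    change x - y ∈ Submodule.torsionBy Lam N (1 - tt)
    rw [Submodule.mem_torsionBy_iff, smul_sub, sub_eq_zero]
    exact Subtype.ext h
  intro q q' h
  obtain ⟨i, x, rfl⟩ := (pair N d).exists_coset q
  obtain ⟨j, y, rfl⟩ := (pair N d).exists_coset q'
  rw [pairToModule_coset, pairToModule_coset, add_assoc, add_assoc, add_right_inj] at h
  fin_cases i <;> fin_cases j <;> simp [pair] at h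
  · exact hX _ _ _ h
  · exact absurd h (key _ _)
  · exact absurd h.symm (key _ _)
  · exact hX _ _ _ h

theorem mem_range_pairToModule (d : N) (e x : M) :
    x ∈ Set.range (pairToModule d e) ↔
      ∃ m ∈ N, x = e + d + (1 - tt) • m ∨ x = e + (1 - tt) • m := by
  constructor
  · rintro ⟨q, rfl⟩
    obtain ⟨i, y, rfl⟩ := (pair N d).exists_coset q
    refine ⟨y, y.2, ?_⟩
    rw [pairToModule_coset]
    fin_cases i
    · exact Or.inl rfl
    · exact Or.inr (by simp [pair])
  · rintro ⟨m, hm, rfl | rfl⟩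
    · exact ⟨(pair N d).coset 0 ⟨m, hm⟩, rfl⟩
    · exact ⟨(pair N d).coset 1 ⟨m, hm⟩, by rw [pairToModule_coset]; simp [pair]⟩

end MedialData

/-- Injective homomorphisms with the same image differ by an isomorphism. -/
theorem ShelfHom.exists_bijective {Q Q' M : Type*} [Shelf Q] [Shelf Q'] {F : Q → M} {E : Q' → M}
    (op : M → M → M) (hF : ∀ x y, F (x ◃ y) = op (F x) (F y))
    (hE : ∀ x y, E (x ◃ y) = op (E x) (E y)) (hFi : Function.Injective F)
    (hEi : Function.Injective E) (h : Set.range F = Set.range E) :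
    ∃ f : Q →◃ Q', Function.Bijective f := by
  have h₁ : ∀ x, ∃ y, E y = F x := fun x => h.le ⟨x, rfl⟩
  have h₂ : ∀ y, ∃ x, F x = E y := fun y => h.ge ⟨y, rfl⟩
  choose f hf using h₁
  refine ⟨⟨f, fun {x y} => hEi ?_⟩, fun x y hxy => hFi ?_, fun y => ?_⟩
  · rw [hf, hF, hE, hf, hf]
  · rw [← hf, ← hf]
    exact congrArg E hxy
  · obtain ⟨x, hx⟩ := h₂ y
    exact ⟨x, hEi ((hf x).trans hx)⟩

/-! ### Comparison of the two images -/

theorem LinkDiagram.range_toModule_eq (D : LinkDiagram) {α₁ α₂ : D.Arc}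
    (hcover : ∀ α, D.componentOf α = D.componentOf α₁ ∨ D.componentOf α = D.componentOf α₂)
    (d : D.alexanderInvariantRed) {m : D.AlexanderModuleRed} (hm : m ∈ D.alexanderInvariantRed)
    (hd : d - (D.arcClass α₁ - D.arcClass α₂) = (1 - tt) • m) :
    Set.range D.toModule = Set.range (MedialData.pairToModule d (D.arcClass α₂)) := by
  have hd' : D.arcClass α₂ + d = D.arcClass α₁ + (1 - tt) • m := by
    rw [← hd]
    abel
  ext x
  rw [mem_range_toModule, MedialData.mem_range_pairToModule, hd']
  constructor
  · rintro ⟨α, n, hn, rfl⟩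
    rcases hcover α with h | h
    · obtain ⟨k, hk, h'⟩ := D.exists_arcClass_sub_eq h
      refine ⟨k + n - m, Submodule.sub_mem _ (Submodule.add_mem _ hk hn) hm, Or.inl ?_⟩
      rw [eq_add_of_sub_eq h']
      module
    · obtain ⟨k, hk, h'⟩ := D.exists_arcClass_sub_eq h
      refine ⟨k + n, Submodule.add_mem _ hk hn, Or.inr ?_⟩
      rw [eq_add_of_sub_eq h']
      module
  · rintro ⟨n, hn, rfl | rfl⟩
    · exact ⟨α₁, m + n, Submodule.add_mem _ hm hn, by module⟩
    · exact ⟨α₂, n, hn, rfl⟩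

theorem mainTheorem4 (D : LinkDiagram) (hD : D.IsClassical) (hμ : D.numComponents = 2) :
    Nonempty ((D.alexanderInvariantRed ⧸ oneSubTMul D.alexanderInvariantRed) ≃+ ℤ) ∧
      ∀ d : D.alexanderInvariantRed,
        Submodule.span Lam {(oneSubTMul D.alexanderInvariantRed).mkQ d} = ⊤ →
          ∃ f : D.MQ →◃ (MedialData.pair D.alexanderInvariantRed d).Q,
            Function.Bijective f := by
  refine ⟨?_, fun d hd => ?_⟩
  · obtain ⟨α₁, α₂, hne, hcover⟩ := D.exists_two_arcs hμ
    exact D.nonempty_addEquiv_int hne hcover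
  · obtain ⟨α₁, α₂, hne, hcover, m, hm, h⟩ := D.exists_arcs_of_span_eq_top hμ d hd
    refine ShelfHom.exists_bijective (fun y x => tt • x + (1 - tt) • y) D.toModule_act
      (MedialData.pairToModule_act d (D.arcClass α₂))
      (D.toModule_injective hD hμ)
      (MedialData.pairToModule_injective d _ ?_) (D.range_toModule_eq hcover d hm h)
    -- If `d` were in `(1 - t) N`, so would be `α₁ - α₂`, and the two arcs would lie on one
    -- component.
    rintro ⟨n, rfl⟩
    refine hne (D.componentOf_eq_of_arcClass_sub_eq (m := n - m) ?_)
    rw [smul_sub, ← h, LinearMap.lsmul_apply, Submodule.coe_smul, sub_sub_cancel]
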